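/- Let $(M,g)$ be a smooth Riemannian manifold (without boundary) of dimension $n$ with Levi-Civita connection $\nabla$, and let $0\le p\le n$. A smooth differential $p$-form $\varphi$ on $M$ is called a conformal Killing (or twistor) form if $$\nabla_X\varphi=\frac{1}{p+1}\,X\lrcorner d\varphi-\frac{1}{n-p+1}\,X^\flat\wedge\delta\varphi$$ for all tangent vectors $X$, where $X^\flat=g(X,\cdot)$ and $\delta\varphi=-\sum_i e_i\lrcorner\nabla_{e_i}\varphi$ for a local orthonormal frame $(e_i)$. A smooth symmetric $(0,2)$-tensor field $K$ is called a conformal Killing tensor if there is a smooth $1$-form $P$ such that $(\nabla_XK)(X,X)=P(X)\,g(X,X)$ for all vector fields $X$. Theorem. Let $\varphi$ and $\psi$ be conformal Killing $p$-forms on $(M,g)$. Then the symmetric tensor field $$K_{\varphi,\psi}(X,Y)=g(X\lrcorner\varphi,\,Y\lrcorner\psi)+g(Y\lrcorner\varphi,\,X\lrcorner\psi)$$ is a conformal Killing tensor. More precisely, for all vector fields $X$, $$(\nabla_XK_{\varphi,\psi})(X,X)=P(X)\,g(X,X),\qquad P(X)=-\frac{2}{n-p+1}\bigl(g(\delta\varphi,\,X\lrcorner\psi)+g(\delta\psi,\,X\lrcorner\varphi)\bigr),$$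 and $P$ is a smooth $1$-form. Here $g$ also denotes the induced inner product on forms, $g(\alpha,\beta)=\sum_{i_1<\dots<i_k}\alpha(e_{i_1},\dots,e_{i_k})\,\beta(e_{i_1},\dots,e_{i_k})$ for $k$-forms, and for $p=0$ forms of degree $-1$ are zero. -/

import Mathlib

open Bundle
open scoped Manifold ContDiff

noncomputable section
namespace ConformalKilling

open FiberBundle VectorField

set_option linter.unusedSectionVars false

/-! Conventions: `M` is a smooth manifold modelled on the finite-dimensional real space `E` through
`I`, with `n = Module.finrank ℝ E`. The Riemannian metric is the family of inner products
`inner ℝ` on the tangent spaces `TangentSpace I x`. Vector fields and forms are sections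
`Π x : M, …`. -/

variable {E : Type*} [NormedAddCommGroup E] [NormedSpace ℝ E] [FiniteDimensional ℝ E]
  {H : Type*} [TopologicalSpace H] (I : ModelWithCorners ℝ E H)
  {M : Type*} [TopologicalSpace M] [ChartedSpace H M]
  [IsManifold I ∞ M] [RiemannianBundle (fun x : M ↦ TangentSpace I x)]

/-- The Koszul expression, which is `⟨∇_X Y, Z⟩` for the Levi-Civita connection:
`2⟨∇_X Y, Z⟩ = X⟨Y,Z⟩ + Y⟨Z,X⟩ - Z⟨X,Y⟩ + ⟨[X,Y],Z⟩ - ⟨[Y,Z],X⟩ + ⟨[Z,X],Y⟩`. -/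
def koszul (X Y Z : Π x : M, TangentSpace I x) (x : M) : ℝ :=
  (1 / 2) * (mvfderiv I (fun y ↦ inner ℝ (Y y) (Z y)) x (X x)
    + mvfderiv I (fun y ↦ inner ℝ (Z y) (X y)) x (Y x)
    - mvfderiv I (fun y ↦ inner ℝ (X y) (Y y)) x (Z x)
    + inner ℝ (mlieBracket I X Y x) (Z x)
    - inner ℝ (mlieBracket I Y Z x) (X x)
    + inner ℝ (mlieBracket I Z X x) (Y x))

/-! ### The Levi-Civita connection -/

variable [IsContMDiffRiemannianBundle I ∞ E
    (fun x : M ↦ TangentSpace I x)]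

instance finiteDimensional_tangentSpace (x : M) : FiniteDimensional ℝ (TangentSpace I x) :=
  inferInstanceAs (FiniteDimensional ℝ E)

instance completeSpace_tangentSpace (x : M) : CompleteSpace (TangentSpace I x) :=
  FiniteDimensional.complete ℝ _

variable {I} in
theorem mdifferentiableAt_inner {X Y : Π x : M, TangentSpace I x} {x : M}
    (hX : MDiffAt (T% X) x) (hY : MDiffAt (T% Y) x) :
    MDiffAt (fun y ↦ (inner ℝ (X y) (Y y) : ℝ)) x :=
  haveI : IsContMDiffRiemannianBundle I 1 E (fun x : M ↦ TangentSpace I x) := inferInstance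
  MDifferentiableAt.inner_bundle (IB := I) (F := E) (E := fun x : M ↦ TangentSpace I x) hX hY

theorem koszul_tensorial_left {Y Z : Π x : M, TangentSpace I x} {x : M}
    (hY : MDiffAt (T% Y) x) (hZ : MDiffAt (T% Z) x) :
    TensorialAt I E (fun X ↦ koszul I X Y Z x) x where
  smul {f X} hf hX := by
    have h1 := mvfderiv_fun_mul hf (mdifferentiableAt_inner hZ hX)
    have h2 := mvfderiv_fun_mul hf (mdifferentiableAt_inner hX hY)
    simp [koszul, inner_smul_left, inner_smul_right, h1, h2, mlieBracket_smul_left hf hX,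
      mlieBracket_smul_right hf hX, inner_add_left]
    rw [real_inner_comm (Z x) (X x)]
    ring
  add {X X'} hX hX' := by
    have h1 := mvfderiv_fun_add (mdifferentiableAt_inner hZ hX) (mdifferentiableAt_inner hZ hX')
    have h2 := mvfderiv_fun_add (mdifferentiableAt_inner hX hY) (mdifferentiableAt_inner hX' hY)
    simp [koszul, inner_add_left, inner_add_right, h1, h2, mlieBracket_add_left hX hX',
      mlieBracket_add_right hX hX']
    ring

theorem koszul_tensorial_right {X Y : Π x : M, TangentSpace I x} {x : M}
    (hX : MDiffAt (T% X) x) (hY : MDiffAt (T% Y) x) :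
    TensorialAt I E (fun Z ↦ koszul I X Y Z x) x where
  smul {f Z} hf hZ := by
    have h1 := mvfderiv_fun_mul hf (mdifferentiableAt_inner hY hZ)
    have h2 := mvfderiv_fun_mul hf (mdifferentiableAt_inner hZ hX)
    simp [koszul, inner_smul_left, inner_smul_right, h1, h2, mlieBracket_smul_left hf hZ,
      mlieBracket_smul_right hf hZ, inner_add_left]
    rw [real_inner_comm (X x) (Z x), real_inner_comm (Z x) (Y x)]
    ring
  add {Z Z'} hZ hZ' := by
    have h1 := mvfderiv_fun_add (mdifferentiableAt_inner hY hZ) (mdifferentiableAt_inner hY hZ')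
    have h2 := mvfderiv_fun_add (mdifferentiableAt_inner hZ hX) (mdifferentiableAt_inner hZ' hX)
    simp [koszul, inner_add_left, inner_add_right, h1, h2, mlieBracket_add_left hZ hZ',
      mlieBracket_add_right hZ hZ']
    ring


open Classical in
/-- The map `Y ↦ ∇ Y` at `x`, obtained from the Koszul expression by Riesz duality. -/
def leviCivitaFun (Y : Π x : M, TangentSpace I x) (x : M) :
    TangentSpace I x →L[ℝ] TangentSpace I x :=
  if hY : MDiffAt (T% Y) x then
    LinearMap.toContinuousLinearMap
      { toFun := fun v ↦ (InnerProductSpace.toDual ℝ (TangentSpace I x)).symm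
          (TensorialAt.mkHom₂ (F := E) (F' := E) (fun X Z ↦ koszul I X Y Z x) x
            (fun _ hZ ↦ koszul_tensorial_left I hY hZ)
            (fun _ hX ↦ koszul_tensorial_right I hX hY) v)
        map_add' := fun v w ↦ by rw [map_add, map_add]
        map_smul' := fun c v ↦ by simp }
  else 0

theorem inner_leviCivitaFun {X Y Z : Π x : M, TangentSpace I x} {x : M}
    (hX : MDiffAt (T% X) x) (hY : MDiffAt (T% Y) x) (hZ : MDiffAt (T% Z) x) :
    inner ℝ (leviCivitaFun I Y x (X x)) (Z x) = koszul I X Y Z x := by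
  rw [leviCivitaFun, dif_pos hY]
  refine (InnerProductSpace.toDual_symm_apply (𝕜 := ℝ) (E := TangentSpace I x)).trans ?_
  exact TensorialAt.mkHom₂_apply _ _ hX hZ

theorem leviCivitaFun_eq {Y : Π x : M, TangentSpace I x} {x : M} (hY : MDiffAt (T% Y) x)
    {A : TangentSpace I x →L[ℝ] TangentSpace I x}
    (h : ∀ X Z : Π x : M, TangentSpace I x, MDiffAt (T% X) x → MDiffAt (T% Z) x →
      koszul I X Y Z x = inner ℝ (A (X x)) (Z x)) : leviCivitaFun I Y x = A := by
  ext1 v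
  refine ext_inner_right ℝ fun w ↦ ?_
  have hv := mdifferentiableAt_extend (I := I) (F := E) v
  have hw := mdifferentiableAt_extend (I := I) (F := E) w
  have h1 := inner_leviCivitaFun I hv hY hw
  rw [h _ _ hv hw] at h1
  simpa using h1

/-- The Levi-Civita connection; `leviCivita I Y x v` is `(∇_v Y) x`.
It is metric and torsion-free, see `leviCivita_isMetricCompatible` and `leviCivita_torsion`. -/
def leviCivita : CovariantDerivative I E (fun x : M ↦ TangentSpace I x) where
  toFun := leviCivitaFun I
  isCovariantDerivativeOnUniv :=
    { add := by
        intro Y Y' x hY hY' _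
        refine leviCivitaFun_eq I (mdifferentiableAt_add_section hY hY') fun X Z hX hZ ↦ ?_
        have h1 := mvfderiv_fun_add (mdifferentiableAt_inner hY hZ) (mdifferentiableAt_inner hY' hZ)
        have h2 := mvfderiv_fun_add (mdifferentiableAt_inner hX hY) (mdifferentiableAt_inner hX hY')
        have h3 := inner_leviCivitaFun I hX hY hZ
        have h4 := inner_leviCivitaFun I hX hY' hZ
        simp only [add_apply, inner_add_left, h3, h4]
        simp [koszul, inner_add_left, inner_add_right, h1, h2, mlieBracket_add_left hY hY',
          mlieBracket_add_right hY hY']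
        ring
      leibniz := by
        intro Y f x hY hf _
        refine leviCivitaFun_eq I (hf.smul_section hY) fun X Z hX hZ ↦ ?_
        have h1 := mvfderiv_fun_mul hf (mdifferentiableAt_inner hY hZ)
        have h2 := mvfderiv_fun_mul hf (mdifferentiableAt_inner hX hY)
        have h3 := inner_leviCivitaFun I hX hY hZ
        simp only [add_apply, inner_add_left, smul_apply,
          inner_smul_left, h3, ContinuousLinearMap.smulRight_apply]
        simp [koszul, inner_smul_left, inner_smul_right, h1, h2, mlieBracket_smul_left hf hY,
          mlieBracket_smul_right hf hY, inner_add_left]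
        rw [real_inner_comm (X x) (Y x)]
        ring }

theorem inner_leviCivita {X Y Z : Π x : M, TangentSpace I x} {x : M}
    (hX : MDiffAt (T% X) x) (hY : MDiffAt (T% Y) x) (hZ : MDiffAt (T% Z) x) :
    inner ℝ (leviCivita I Y x (X x)) (Z x) = koszul I X Y Z x :=
  inner_leviCivitaFun I hX hY hZ

theorem mvfderiv_inner_eq {X Y Z : Π x : M, TangentSpace I x} {x : M}
    (hX : MDiffAt (T% X) x) (hY : MDiffAt (T% Y) x) (hZ : MDiffAt (T% Z) x) :
    mvfderiv I (fun y ↦ (inner ℝ (Y y) (Z y) : ℝ)) x (X x)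
      = inner ℝ (leviCivita I Y x (X x)) (Z x) + inner ℝ (Y x) (leviCivita I Z x (X x)) := by
  have h1 := inner_leviCivita I hX hY hZ
  have h2 := inner_leviCivita I hX hZ hY
  rw [h1, real_inner_comm, h2, koszul, koszul, mlieBracket_swap_apply (V := Z) (W := Y),
    mlieBracket_swap_apply (V := X) (W := Z), mlieBracket_swap_apply (V := Y) (W := X)]
  simp only [inner_neg_left]
  simp only [real_inner_comm (X _), real_inner_comm (Y _) (Z _)]
  ring

theorem leviCivita_isMetricCompatible :
    haveI : IsContMDiffRiemannianBundle I 1 E (fun x : M ↦ TangentSpace I x) := inferInstance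
    CovariantDerivative.IsMetricCompatible (V := fun x : M ↦ TangentSpace I x)
      (leviCivita I (M := M)) := by
  have : IsContMDiffRiemannianBundle I 1 E (fun x : M ↦ TangentSpace I x) := inferInstance
  rw [CovariantDerivative.isMetricCompatible_iff]
  intro x X Y Z hX hY hZ
  exact mvfderiv_inner_eq I hX hY hZ

theorem leviCivita_torsion : (leviCivita I (M := M)).torsion = 0 := by
  rw [CovariantDerivative.torsion_eq_zero_iff]
  intro X Y x hX hY
  refine ext_inner_right ℝ fun w ↦ ?_
  have hw := mdifferentiableAt_extend (I := I) (F := E) w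
  have h1 := inner_leviCivita I hX hY hw
  have h2 := inner_leviCivita I hY hX hw
  simp only [extend_apply_self] at h1 h2
  rw [inner_sub_left, h1, h2, koszul, koszul, mlieBracket_swap_apply (V := Y) (W := X),
    mlieBracket_swap_apply (V := extend E w) (W := X), mlieBracket_swap_apply (V := extend E w) (W := Y)]
  simp only [inner_neg_left, extend_apply_self]
  simp only [real_inner_comm (X _), real_inner_comm (Y _) (extend E w _)]
  ring


/-! ### Linear algebra of exterior forms -/
section LinearAlgebra

variable {V : Type*} [NormedAddCommGroup V] [InnerProductSpace ℝ V]

/-- Interior product `v ⌟ φ` of a `p`-form, a form of degree `p - 1`; a `0`-form has zero interior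
product (there are no nonzero forms of degree `-1`). -/
def interior : {p : ℕ} → V → V [⋀^Fin p]→L[ℝ] ℝ → V [⋀^Fin (p - 1)]→L[ℝ] ℝ
  | 0, _, _ => 0
  | _ + 1, v, φ => φ.curryLeft v

/-- The wedge product `v♭ ∧ β` of (the 1-form dual to) a vector with a form of degree `p - 1`:
`(v♭ ∧ β)(w₀, …, w_k) = ∑ i, (-1)^i ⟨v, w_i⟩ β(w₀, …, ŵ_i, …, w_k)`.
For `p = 0` it is zero, as there are no nonzero forms of degree `-1`. -/
def wedge : {p : ℕ} → V → V [⋀^Fin (p - 1)]→L[ℝ] ℝ → V [⋀^Fin p]→L[ℝ] ℝ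
  | 0, _, _ => 0
  | _ + 1, v, β => ContinuousAlternatingMap.alternatizeUncurryFin ((innerSL ℝ v).smulRight β)

/-- The inner product of `k`-forms: with an orthonormal basis `e`, the sum over
`i₁ < ⋯ < i_k` of `α(e_{i₁}, …, e_{i_k}) β(e_{i₁}, …, e_{i_k})`, written as `1 / k!` times the sum
over all index tuples. -/
def innerForm [FiniteDimensional ℝ V] {k : ℕ} (α β : V [⋀^Fin k]→L[ℝ] ℝ) : ℝ :=
  (1 / (k.factorial : ℝ)) * ∑ s : Fin k → Fin (Module.finrank ℝ V),
    α (fun i ↦ stdOrthonormalBasis ℝ V (s i)) * β (fun i ↦ stdOrthonormalBasis ℝ V (s i))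

/-- The form `(w₁, …, w_p) ↦ ∑ i, φ(w₁, …, A w_i, …, w_p)`, see `derivation_apply`. -/
def derivation {p : ℕ} (A : V →L[ℝ] V) (φ : V [⋀^Fin p]→L[ℝ] ℝ) : V [⋀^Fin p]→L[ℝ] ℝ :=
  { ∑ i, φ.toContinuousMultilinearMap.compContinuousLinearMap
      (fun j ↦ if j = i then A else ContinuousLinearMap.id ℝ V) with
    map_eq_zero_of_eq' := by
      intro v i j hv hij
      have key : ∀ k, (φ.toContinuousMultilinearMap.compContinuousLinearMap
          (fun j ↦ if j = k then A else ContinuousLinearMap.id ℝ V)) v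
          = φ (Function.update v k (A (v k))) := by
        intro k
        change φ _ = φ _
        congr 1
        ext l
        by_cases h : l = k
        · subst h; simp
        · simp [h]
      change (∑ k, φ.toContinuousMultilinearMap.compContinuousLinearMap
          (fun j ↦ if j = k then A else ContinuousLinearMap.id ℝ V)) v = 0
      rw [sum_apply]
      simp_rw [key]
      rw [Finset.sum_eq_add_of_mem i j (Finset.mem_univ _) (Finset.mem_univ _) hij]
      · have h : Function.update v j (A (v j))
            = Function.update v i (A (v i)) ∘ Equiv.swap i j := by
          ext l
          rcases eq_or_ne l i with rfl | hi
          · simp [hij, hv, hij.symm]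
          rcases eq_or_ne l j with rfl | hj
          · simp [hv]
          · simp [Equiv.swap_apply_of_ne_of_ne hi hj, hi, hj]
        rw [h]
        exact add_eq_zero_iff_eq_neg.2 (by rw [show φ _ = _ from φ.toAlternatingMap.map_swap (Function.update v i (A (v i))) hij]; exact (neg_neg _).symm)
      · intro k _ hk
        exact φ.map_eq_zero_of_eq _ (by simp [hk.1.symm, hk.2.symm, hv]) hij }

theorem derivation_apply {p : ℕ} (A : V →L[ℝ] V) (φ : V [⋀^Fin p]→L[ℝ] ℝ) (v : Fin p → V) :
    derivation A φ v = ∑ i, φ (Function.update v i (A (v i))) := by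
  change (∑ k, φ.toContinuousMultilinearMap.compContinuousLinearMap
    (fun j ↦ if j = k then A else ContinuousLinearMap.id ℝ V)) v = _
  rw [sum_apply]
  refine Finset.sum_congr rfl fun k _ ↦ ?_
  change φ _ = φ _
  congr 1
  ext l
  by_cases h : l = k
  · subst h; simp
  · simp [h]

theorem interior_add {p : ℕ} (v w : V) (φ : V [⋀^Fin p]→L[ℝ] ℝ) :
    interior (v + w) φ = interior v φ + interior w φ := by
  cases p <;> simp [interior]

theorem interior_smul {p : ℕ} (c : ℝ) (v : V) (φ : V [⋀^Fin p]→L[ℝ] ℝ) :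
    interior (c • v) φ = c • interior v φ := by
  cases p <;> simp [interior]

variable [FiniteDimensional ℝ V]

theorem innerForm_add_left {k : ℕ} (α α' β : V [⋀^Fin k]→L[ℝ] ℝ) :
    innerForm (α + α') β = innerForm α β + innerForm α' β := by
  simp [innerForm, add_mul, Finset.sum_add_distrib, mul_add]

theorem innerForm_smul_left {k : ℕ} (c : ℝ) (α β : V [⋀^Fin k]→L[ℝ] ℝ) :
    innerForm (c • α) β = c * innerForm α β := by
  simp [innerForm, Finset.mul_sum]
  refine Finset.sum_congr rfl fun s _ ↦ by ring

theorem innerForm_comm {k : ℕ} (α β : V [⋀^Fin k]→L[ℝ] ℝ) :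
    innerForm α β = innerForm β α := by
  simp [innerForm, mul_comm]

theorem innerForm_add_right {k : ℕ} (α β β' : V [⋀^Fin k]→L[ℝ] ℝ) :
    innerForm α (β + β') = innerForm α β + innerForm α β' := by
  simp only [innerForm_comm α, innerForm_add_left]

theorem innerForm_smul_right {k : ℕ} (c : ℝ) (α β : V [⋀^Fin k]→L[ℝ] ℝ) :
    innerForm α (c • β) = c * innerForm α β := by
  simp only [innerForm_comm α, innerForm_smul_left]

/-- `(v, w) ↦ ⟨v ⌟ φ, w ⌟ ψ⟩ + ⟨w ⌟ φ, v ⌟ ψ⟩`. -/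
def killingBilin {p : ℕ} (φ ψ : V [⋀^Fin p]→L[ℝ] ℝ) : V →L[ℝ] V →L[ℝ] ℝ :=
  (LinearMap.mk₂ ℝ
    (fun v w ↦ innerForm (interior v φ) (interior w ψ) + innerForm (interior w φ) (interior v ψ))
    (fun v v' w ↦ by simp only [interior_add, innerForm_add_left, innerForm_add_right]; ring)
    (fun c v w ↦ by
      simp only [interior_smul, innerForm_smul_left, innerForm_smul_right, smul_eq_mul]; ring)
    (fun v w w' ↦ by simp only [interior_add, innerForm_add_left, innerForm_add_right]; ring)
    (fun c v w ↦ by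
      simp only [interior_smul, innerForm_smul_left, innerForm_smul_right, smul_eq_mul];
      ring)).toContinuousBilinearMap

theorem killingBilin_apply {p : ℕ} (φ ψ : V [⋀^Fin p]→L[ℝ] ℝ) (v w : V) :
    killingBilin φ ψ v w
      = innerForm (interior v φ) (interior w ψ) + innerForm (interior w φ) (interior v ψ) :=
  rfl

/-- `v ↦ ⟨α, v ⌟ ψ⟩ + ⟨β, v ⌟ φ⟩`. -/
def contractedPairing {p : ℕ} (α β : V [⋀^Fin (p - 1)]→L[ℝ] ℝ) (φ ψ : V [⋀^Fin p]→L[ℝ] ℝ) :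
    V →L[ℝ] ℝ :=
  LinearMap.toContinuousLinearMap
    { toFun := fun v ↦ innerForm α (interior v ψ) + innerForm β (interior v φ)
      map_add' := fun v w ↦ by simp only [interior_add, innerForm_add_right]; ring
      map_smul' := fun c v ↦ by
        simp only [interior_smul, innerForm_smul_right, smul_eq_mul, RingHom.id_apply]; ring }

end LinearAlgebra

/-! ### Differential forms on a Riemannian manifold -/

/-- The extension of a tangent vector at `x` to the local vector field with constant coordinates in
the trivialization of the tangent bundle at `x`: near `x`, `extendL I x y v` is Mathlib's
`FiberBundle.extend E v y`. -/
def extendL (x y : M) : TangentSpace I x →L[ℝ] TangentSpace I y :=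
  (trivializationAt E (TangentSpace I) x).symmL ℝ y ∘L
    (trivializationAt E (TangentSpace I) x).continuousLinearMapAt ℝ x

theorem extendL_apply {x y : M}
    (hy : y ∈ (trivializationAt E (TangentSpace I : M → Type _) x).baseSet)
    (v : TangentSpace I x) : extendL I x y v = extend E v y := by
  simp only [extendL, extend, ContinuousLinearMap.comp_apply]
  rw [Trivialization.continuousLinearMapAt_apply, Trivialization.linearMapAt_apply,
    if_pos (FiberBundle.mem_baseSet_trivializationAt' x), Trivialization.symmL_apply _ hy]

theorem extendL_self (x : M) (v : TangentSpace I x) : extendL I x x v = v := by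
  rw [extendL_apply I (FiberBundle.mem_baseSet_trivializationAt' x), extend_apply_self]

theorem mdifferentiableAt_extendL (x : M) (v : TangentSpace I x) :
    MDiffAt (T% (fun y ↦ extendL I x y v)) x := by
  refine (mdifferentiableAt_extend I E v).congr_of_eventuallyEq ?_
  filter_upwards [(trivializationAt E (TangentSpace I : M → Type _) x).open_baseSet.mem_nhds
    (FiberBundle.mem_baseSet_trivializationAt' x)] with y hy
  rw [extendL_apply I hy]

/-- The coordinate expression near `x` of a form: `y ↦ φ_y` read on `T_x M`, with
`localRep I φ x y (w₁, …, w_p) = φ_y(W₁ y, …, W_p y)`, where `W_i` is the extension of `w_i` near `x`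
with constant coordinates. -/
def localRep {p : ℕ} (φ : Π x : M, TangentSpace I x [⋀^Fin p]→L[ℝ] ℝ) (x y : M) :
    TangentSpace I x [⋀^Fin p]→L[ℝ] ℝ :=
  (φ y).compContinuousLinearMap (extendL I x y)

/-- Smoothness of a differential form: its local coordinate expressions are smooth. -/
def IsSmoothForm {p : ℕ} (φ : Π x : M, TangentSpace I x [⋀^Fin p]→L[ℝ] ℝ) : Prop :=
  ∀ x : M, ContMDiffAt I 𝓘(ℝ, TangentSpace I x [⋀^Fin p]→L[ℝ] ℝ) ∞ (localRep I φ x) x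

/-- The connection form (Christoffel symbols) at `x`: `w ↦ ∇_v W` for the extension `W` of `w` with
constant coordinates near `x`. -/
def connectionForm (x : M) (v : TangentSpace I x) : TangentSpace I x →L[ℝ] TangentSpace I x :=
  LinearMap.toContinuousLinearMap
    { toFun := fun w ↦ leviCivita I (fun y ↦ extendL I x y w) x v
      map_add' := by
        intro w w'
        have h := (leviCivita I).isCovariantDerivativeOn.add (mdifferentiableAt_extendL I x w)
          (mdifferentiableAt_extendL I x w')
        have h' : (fun y ↦ extendL I x y (w + w'))
            = (fun y ↦ extendL I x y w) + fun y ↦ extendL I x y w' := by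
          ext y; simp
        rw [h']
        exact congrArg (fun A ↦ A v) h
      map_smul' := by
        intro c w
        have h := (leviCivita I).isCovariantDerivativeOn.smul_const c
          (mdifferentiableAt_extendL I x w)
        have h' : (fun y ↦ extendL I x y (c • w)) = c • fun y ↦ extendL I x y w := by
          ext y; simp
        rw [h']
        exact congrArg (fun A ↦ A v) h }

/-- The covariant derivative of a `p`-form,
`(∇_v φ)(w₁, …, w_p) = v(φ(W₁, …, W_p)) - ∑ i, φ(w₁, …, ∇_v W_i, …, w_p)`,
where `W_i` extends `w_i` with constant coordinates near `x`; see `covDerivForm_apply`. -/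
def covDerivForm {p : ℕ} (φ : Π x : M, TangentSpace I x [⋀^Fin p]→L[ℝ] ℝ) (x : M)
    (v : TangentSpace I x) : TangentSpace I x [⋀^Fin p]→L[ℝ] ℝ :=
  mvfderiv I (localRep I φ x) x v - derivation (connectionForm I x v) (φ x)

theorem covDerivForm_apply {p : ℕ} {φ : Π x : M, TangentSpace I x [⋀^Fin p]→L[ℝ] ℝ} {x : M}
    (hφ : MDifferentiableAt I 𝓘(ℝ, TangentSpace I x [⋀^Fin p]→L[ℝ] ℝ) (localRep I φ x) x)
    (v : TangentSpace I x) (w : Fin p → TangentSpace I x) :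
    covDerivForm I φ x v w
      = mvfderiv I (fun y ↦ φ y (fun i ↦ extendL I x y (w i))) x v
        - ∑ i, φ x (Function.update w i (leviCivita I (fun y ↦ extendL I x y (w i)) x v)) := by
  have h2 := mvfderiv_comp_apply x
    ((ContinuousAlternatingMap.apply ℝ (TangentSpace I x) ℝ w).mdifferentiableAt) hφ v
  rw [covDerivForm, ContinuousAlternatingMap.sub_apply, derivation_apply]
  congr 1
  refine Eq.trans ?_ h2.symm
  rw [mvfderiv, mvfderiv, ContinuousLinearMap.mfderiv_eq]
  rfl

/-- The codifferential `δφ = -∑ i, e_i ⌟ ∇_{e_i} φ`, for an orthonormal basis `e` of `T_x M`. -/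
def codiff {p : ℕ} (φ : Π x : M, TangentSpace I x [⋀^Fin p]→L[ℝ] ℝ) (x : M) :
    TangentSpace I x [⋀^Fin (p - 1)]→L[ℝ] ℝ :=
  -∑ i, interior (stdOrthonormalBasis ℝ (TangentSpace I x) i)
    (covDerivForm I φ x (stdOrthonormalBasis ℝ (TangentSpace I x) i))

/-- The exterior derivative of a form: at `x`, the exterior derivative in the model space of the
pullback of `φ` by the inverse of the chart at `x`, pulled back to `T_x M`. -/
def extDerivForm {p : ℕ} (φ : Π x : M, TangentSpace I x [⋀^Fin p]→L[ℝ] ℝ) (x : M) :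
    TangentSpace I x [⋀^Fin (p + 1)]→L[ℝ] ℝ :=
  (extDerivWithin (fun z : E ↦ (φ ((extChartAt I x).symm z)).compContinuousLinearMap
      (mfderivWithin 𝓘(ℝ, E) I (extChartAt I x).symm (Set.range I) z))
    (Set.range I) (extChartAt I x x)).compContinuousLinearMap
      (mfderiv I 𝓘(ℝ, E) (extChartAt I x) x)

/-- A conformal Killing (twistor) `p`-form: a smooth `p`-form with
`∇_X φ = 1/(p+1) X ⌟ dφ - 1/(n-p+1) X ∧ δφ`. -/
structure IsConformalKillingForm {p : ℕ} (φ : Π x : M, TangentSpace I x [⋀^Fin p]→L[ℝ] ℝ) :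
    Prop where
  smooth : IsSmoothForm I φ
  eq : ∀ (x : M) (v : TangentSpace I x), covDerivForm I φ x v =
    (1 / ((p : ℝ) + 1)) • (extDerivForm I φ x).curryLeft v
      - (1 / ((Module.finrank ℝ E : ℝ) - p + 1)) • wedge v (codiff I φ x)

/-- `(∇_X K)(Y, Z) = X(K(Y, Z)) - K(∇_X Y, Z) - K(Y, ∇_X Z)`. -/
def covDerivBilin (K : Π x : M, TangentSpace I x →L[ℝ] TangentSpace I x →L[ℝ] ℝ)
    (X Y Z : Π x : M, TangentSpace I x) (x : M) : ℝ :=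
  mvfderiv I (fun y ↦ K y (Y y) (Z y)) x (X x)
    - K x (leviCivita I Y x (X x)) (Z x) - K x (Y x) (leviCivita I Z x (X x))

/-- `P` is a smooth 1-form with `(∇_X K)(X, X) = P(X) g(X, X)` for all smooth (locally defined) vector
fields `X`. -/
structure IsAssociatedOneForm (K : Π x : M, TangentSpace I x →L[ℝ] TangentSpace I x →L[ℝ] ℝ)
    (P : Π x : M, TangentSpace I x →L[ℝ] ℝ) : Prop where
  smooth : ContMDiff I (I.prod 𝓘(ℝ, E →L[ℝ] ℝ)) ∞
    (fun x : M ↦ TotalSpace.mk' (E →L[ℝ] ℝ) (E := fun x : M ↦ TangentSpace I x →L[ℝ] ℝ) x (P x))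
  eq : ∀ (x : M) (X : Π x : M, TangentSpace I x), CMDiffAt ∞ (T% X) x →
    covDerivBilin I K X X X x = P x (X x) * inner ℝ (X x) (X x)

/-- A conformal Killing tensor: a smooth symmetric `(0,2)`-tensor field `K` for which there is a
1-form `P` with `(∇_X K)(X, X) = P(X) g(X, X)`. -/
structure IsConformalKillingTensor
    (K : Π x : M, TangentSpace I x →L[ℝ] TangentSpace I x →L[ℝ] ℝ) : Prop where
  smooth : ContMDiff I (I.prod 𝓘(ℝ, E →L[ℝ] E →L[ℝ] ℝ)) ∞
    (fun x : M ↦ TotalSpace.mk' (E →L[ℝ] E →L[ℝ] ℝ)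
      (E := fun x : M ↦ TangentSpace I x →L[ℝ] TangentSpace I x →L[ℝ] ℝ) x (K x))
  symm : ∀ (x : M) (v w : TangentSpace I x), K x v w = K x w v
  exists_oneForm : ∃ P : Π x : M, TangentSpace I x →L[ℝ] ℝ, IsAssociatedOneForm I K P

/-- `K_{φ,ψ}(X, Y) = g(X ⌟ φ, Y ⌟ ψ) + g(Y ⌟ φ, X ⌟ ψ)`. -/
def killingTensor {p : ℕ} (φ ψ : Π x : M, TangentSpace I x [⋀^Fin p]→L[ℝ] ℝ) (x : M) :
    TangentSpace I x →L[ℝ] TangentSpace I x →L[ℝ] ℝ :=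
  killingBilin (φ x) (ψ x)

/-- The 1-form `X ↦ -2/(n-p+1) (g(δφ, X ⌟ ψ) + g(δψ, X ⌟ φ))`. -/
def killingOneForm {p : ℕ} (φ ψ : Π x : M, TangentSpace I x [⋀^Fin p]→L[ℝ] ℝ) (x : M) :
    TangentSpace I x →L[ℝ] ℝ :=
  (-(2 / ((Module.finrank ℝ E : ℝ) - p + 1))) •
    contractedPairing (codiff I φ x) (codiff I ψ x) (φ x) (ψ x)

end ConformalKilling

end

open ConformalKilling

/-!
The identity `(∇_X K)(X, X) = P(X) g(X, X)` is pointwise once `∇_X` is known to satisfy the Leibniz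
rule for the contraction `⟨U ⌟ φ, V ⌟ ψ⟩`. Granted that rule, the terms with `∇_X X` cancel and
`(∇_X K)(X, X) = 2⟨X ⌟ ∇_X φ, X ⌟ ψ⟩ + 2⟨X ⌟ φ, X ⌟ ∇_X ψ⟩` (`covDerivBilin_killingTensor`).
Substituting the twistor equation, the part `X ⌟ dφ` of `∇_X φ` drops out as `X ⌟ X ⌟ dφ = 0`, and
`X ⌟ (X♭ ∧ δφ) = |X|² δφ - X♭ ∧ (X ⌟ δφ)`, whose last term is orthogonal to `X ⌟ ψ` because
`X ⌟ X ⌟ ψ = 0` (`innerForm_interior_twistor`). What remains is `P(X) g(X, X)`.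

The Leibniz rule (`mvfderiv_innerForm_interior`) is obtained by computing the contraction in a
smooth local orthonormal frame, which exists by the Gram–Schmidt process
(`exists_orthonormalFrame`); this is legitimate because the inner product of forms does not depend
on the orthonormal basis (`innerForm_eq_sum`). The derivatives of the frame enter through a skew-symmetric endomorphism, so
that their contributions cancel (`sum_update_mul_add_mul_update_eq_zero`).

Smoothness of `P` needs no differentiation of the codifferential: along a nonvanishing coordinate
field `X` the identity itself gives `P(X) = (∇_X K)(X, X) / g(X, X)`, and the right-hand side is
smooth because `∇` maps smooth fields to smooth fields (`contMDiffAt_leviCivita`).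
-/

namespace ConformalKilling

set_option linter.unusedSectionVars false

/-! ### Inner products of exterior forms -/

section LinearAlgebra

variable {V : Type*} [NormedAddCommGroup V] [InnerProductSpace ℝ V] {ι ι' : Type*}
  [Fintype ι] [Fintype ι']

/-- The contraction `∑ₛ α(e_{s₁}, …, e_{s_k}) β(e_{s₁}, …, e_{s_k})` over an orthonormal basis does
not depend on the basis. -/
theorem sum_apply_orthonormalBasis_eq {k : ℕ} (α β : V [⋀^Fin k]→L[ℝ] ℝ)
    (b : OrthonormalBasis ι ℝ V) (c : OrthonormalBasis ι' ℝ V) :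
    ∑ s : Fin k → ι, α (fun i ↦ b (s i)) * β (fun i ↦ b (s i))
      = ∑ s : Fin k → ι', α (fun i ↦ c (s i)) * β (fun i ↦ c (s i)) := by
  classical
  have expand (γ : V [⋀^Fin k]→L[ℝ] ℝ) (s : Fin k → ι) : γ (fun i ↦ b (s i))
      = ∑ t : Fin k → ι', (∏ i, inner ℝ (c (t i)) (b (s i))) * γ (fun i ↦ c (t i)) := by
    have h : (fun i ↦ b (s i)) = fun i ↦ ∑ j, (inner ℝ (c j) (b (s i)) : ℝ) • c j := by
      ext i
      exact (c.sum_repr' _).symm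
    rw [h]
    refine (γ.toMultilinearMap.map_sum _).trans (Finset.sum_congr rfl fun t _ ↦ ?_)
    exact (γ.toMultilinearMap.map_smul_univ _ _)
  have orth (t u : Fin k → ι') : ∑ s : Fin k → ι,
      (∏ i, (inner ℝ (c (t i)) (b (s i)) : ℝ)) * ∏ i, (inner ℝ (c (u i)) (b (s i)) : ℝ)
        = if t = u then 1 else 0 := by
    simp_rw [← Finset.prod_mul_distrib]
    rw [← Fintype.prod_sum fun i j ↦ (inner ℝ (c (t i)) (b j) : ℝ) * inner ℝ (c (u i)) (b j)]
    have h (i : Fin k) : ∑ j, (inner ℝ (c (t i)) (b j) : ℝ) * inner ℝ (c (u i)) (b j)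
        = if t i = u i then 1 else 0 := by
      rw [← orthonormal_iff_ite.1 c.orthonormal (t i) (u i), ← b.sum_inner_mul_inner]
      simp only [real_inner_comm (c (u i))]
    simp_rw [h, Finset.prod_ite_zero, funext_iff]
    simp
  simp_rw [expand, Finset.sum_mul_sum]
  rw [Finset.sum_comm]
  refine Finset.sum_congr rfl fun t _ ↦ ?_
  rw [Finset.sum_comm]
  have h (u : Fin k → ι') : ∑ s : Fin k → ι,
      (∏ i, (inner ℝ (c (t i)) (b (s i)) : ℝ)) * α (fun i ↦ c (t i))
        * ((∏ i, (inner ℝ (c (u i)) (b (s i)) : ℝ)) * β (fun i ↦ c (u i)))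
      = (if t = u then 1 else 0) * (α (fun i ↦ c (t i)) * β (fun i ↦ c (u i))) := by
    rw [← orth t u, Finset.sum_mul]
    exact Finset.sum_congr rfl fun s _ ↦ by ring
  simp [h]

theorem sum_inner_mul_apply_update {k : ℕ} (γ : V [⋀^Fin k]→L[ℝ] ℝ) (b : OrthonormalBasis ι ℝ V)
    (w : Fin k → V) (l : Fin k) (u : V) :
    ∑ j, inner ℝ (b j) u * γ (Function.update w l (b j)) = γ (Function.update w l u) := by
  conv_rhs => rw [← b.sum_repr' u]
  exact Eq.trans (Finset.sum_congr rfl fun j _ ↦ (γ.toMultilinearMap.map_update_smul _ _ _ _).symm)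
    (γ.toMultilinearMap.map_update_sum _ _ _ _).symm

/-- The derivation induced on forms by a skew-symmetric endomorphism is skew-symmetric. The
endomorphism is given by its values `a i` on an orthonormal basis. -/
theorem sum_update_mul_add_mul_update_eq_zero {k : ℕ} (α β : V [⋀^Fin k]→L[ℝ] ℝ)
    (b : OrthonormalBasis ι ℝ V) (a : ι → V)
    (ha : ∀ i j, inner ℝ (a i) (b j) + inner ℝ (b i) (a j) = (0 : ℝ)) :
    ∑ s : Fin k → ι,
      ((∑ l, α (Function.update (fun i ↦ b (s i)) l (a (s l)))) * β (fun i ↦ b (s i))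
        + α (fun i ↦ b (s i)) * ∑ l, β (Function.update (fun i ↦ b (s i)) l (a (s l)))) = 0 := by
  classical
  have expand (γ : V [⋀^Fin k]→L[ℝ] ℝ) (s : Fin k → ι) (l : Fin k) :
      γ (Function.update (fun i ↦ b (s i)) l (a (s l)))
      = ∑ j, inner ℝ (b j) (a (s l)) * γ (fun i ↦ b (Function.update s l j i)) := by
    rw [← sum_inner_mul_apply_update γ b]
    refine Finset.sum_congr rfl fun j _ ↦ ?_
    congr 2
    ext i
    rcases eq_or_ne i l with rfl | h <;> simp [*]
  simp_rw [expand, Finset.sum_add_distrib, Finset.sum_mul, Finset.mul_sum]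
  rw [Finset.sum_comm, Finset.sum_comm (s := Finset.univ) (t := Finset.univ)
    (f := fun (s : Fin k → ι) (l : Fin k) ↦ ∑ j, α (fun i ↦ b (s i)) *
      (inner ℝ (b j) (a (s l)) * β (fun i ↦ b (Function.update s l j i)))),
    ← Finset.sum_add_distrib]
  refine Finset.sum_eq_zero fun l _ ↦ ?_
  rw [← Fintype.sum_prod_type', ← Fintype.sum_prod_type']
  -- The involution exchanging `s l` with the free index `j` matches the two sums term by term.
  let σ : ((Fin k → ι) × ι) ≃ ((Fin k → ι) × ι) :=
    { toFun := fun q ↦ (Function.update q.1 l q.2, q.1 l)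
      invFun := fun q ↦ (Function.update q.1 l q.2, q.1 l)
      left_inv := fun q ↦ by simp
      right_inv := fun q ↦ by simp }
  rw [← Equiv.sum_comp σ, ← Finset.sum_add_distrib]
  refine Finset.sum_eq_zero fun q _ ↦ ?_
  have h := ha (q.1 l) q.2
  rw [real_inner_comm] at h
  simp only [σ, Equiv.coe_fn_mk, Function.update_self, Function.update_idem,
    Function.update_eq_self]
  linear_combination (α (fun i ↦ b (q.1 i)) * β fun i ↦ b (Function.update q.1 l q.2 i)) * h

variable [FiniteDimensional ℝ V]

theorem innerForm_eq_sum {k : ℕ} (α β : V [⋀^Fin k]→L[ℝ] ℝ) (b : OrthonormalBasis ι ℝ V) :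
    innerForm α β = (1 / (k.factorial : ℝ)) *
      ∑ s : Fin k → ι, α (fun i ↦ b (s i)) * β (fun i ↦ b (s i)) := by
  rw [innerForm, sum_apply_orthonormalBasis_eq α β _ b]

/-- In `v ⌟ (v♭ ∧ β) = ‖v‖² β - v♭ ∧ (v ⌟ β)` the last term is orthogonal to `v ⌟ ψ`, because
`v ⌟ (v ⌟ ψ) = 0`. -/
theorem innerForm_interior_wedge {p : ℕ} (v : V) (β : V [⋀^Fin (p - 1)]→L[ℝ] ℝ)
    (ψ : V [⋀^Fin p]→L[ℝ] ℝ) :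
    innerForm (interior v (wedge v β)) (interior v ψ)
      = inner ℝ v v * innerForm β (interior v ψ) := by
  cases p with
  | zero => simp [interior, innerForm]
  | succ k =>
    let b := stdOrthonormalBasis ℝ V
    change innerForm (k := k) _ _ = _ * innerForm (k := k) _ _
    rw [innerForm_eq_sum _ _ b, innerForm_eq_sum _ _ b, mul_left_comm]
    congr 1
    rw [Finset.mul_sum]
    have h1 (w : Fin k → V) : interior v (wedge (p := k + 1) v β) w = inner ℝ v v * β w
        + ∑ i : Fin k, (-1) ^ (i + 1 : ℕ) * (inner ℝ v (w i) *
            β (i.succ.removeNth (Fin.cons v w : Fin (k + 1) → V))) := by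
      change ContinuousAlternatingMap.alternatizeUncurryFin ((innerSL ℝ v).smulRight β)
        (Matrix.vecCons v w) = _
      rw [ContinuousAlternatingMap.alternatizeUncurryFin_apply, Fin.sum_univ_succ]
      simp [Matrix.vecCons]
    simp_rw [h1, add_mul, Finset.sum_add_distrib, Finset.sum_mul]
    rw [Finset.sum_comm, Finset.sum_eq_zero (s := (Finset.univ : Finset (Fin k))), add_zero]
    · simp_rw [mul_assoc]
    · intro i _
      obtain ⟨m, rfl⟩ : ∃ m, k = m + 1 := ⟨k - 1, by have := i.2; omega⟩
      -- Summing over the `i`-th index first leaves `ψ` evaluated twice at `v`.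
      rw [← (Fin.insertNthEquiv (fun _ ↦ Fin (Module.finrank ℝ V)) i).sum_comp,
        Fintype.sum_prod_type, Finset.sum_comm]
      refine Finset.sum_eq_zero fun t _ ↦ ?_
      have h2 (a) : (fun j ↦ b ((Fin.insertNthEquiv (fun _ ↦ Fin (Module.finrank ℝ V)) i) (a, t) j))
          = i.insertNth (b a) (fun j ↦ b (t j)) := by
        ext j
        obtain rfl | ⟨j, rfl⟩ := Fin.eq_self_or_eq_succAbove i j <;> simp
      have h3 (u : V) (w : Fin m → V) : i.succ.removeNth
          (Fin.cons v (i.insertNth u w : Fin (m + 1) → V) : Fin (m + 2) → V) = Fin.cons v w := by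
        ext j
        refine Fin.cases ?_ (fun j ↦ ?_) j <;> simp [Fin.removeNth]
      have h4 : ∑ a, inner ℝ v (b a) *
          interior v ψ (i.insertNth (b a) (fun j ↦ b (t j)) : Fin (m + 1) → V) = 0 := by
        have h5 (u : V) : (i.insertNth u (fun j ↦ b (t j)) : Fin (m + 1) → V)
            = Function.update (i.insertNth 0 (fun j ↦ b (t j)) : Fin (m + 1) → V) i u := by
          simp
        have h6 : interior v ψ (i.insertNth v (fun j ↦ b (t j)) : Fin (m + 1) → V) = 0 := by
          refine ψ.map_eq_zero_of_eq (i := 0) (j := i.succ) _ ?_ (Fin.succ_ne_zero i).symm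
          simp
        rw [← h6, h5 v, ← sum_inner_mul_apply_update (k := m + 1) _ b]
        exact Finset.sum_congr rfl fun a _ ↦ by rw [h5 (b a), real_inner_comm]
      refine Eq.trans (Finset.sum_congr rfl fun a _ ↦ ?_) ((Finset.mul_sum _ _
        ((-1) ^ (i + 1 : ℕ) * β (Fin.cons v (fun j ↦ b (t j)) : Fin (m + 1) → V))).symm.trans
        (by rw [h4, mul_zero]))
      have h7 := congrArg β (h3 (b a) fun j ↦ b (t j))
      rw [h2, ← h7, Fin.insertNthEquiv_apply, Fin.insertNth_apply_same]
      ring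

/-- In the twistor equation the term `v ⌟ η` does not contribute to the contraction with
`v ⌟ ψ`. -/
theorem innerForm_interior_twistor {p : ℕ} (v : V) (a c : ℝ) (η : V [⋀^Fin (p + 1)]→L[ℝ] ℝ)
    (δ : V [⋀^Fin (p - 1)]→L[ℝ] ℝ) (ψ : V [⋀^Fin p]→L[ℝ] ℝ) :
    innerForm (interior v (a • η.curryLeft v - c • wedge v δ)) (interior v ψ)
      = -c * inner ℝ v v * innerForm δ (interior v ψ) := by
  have h : interior v (a • η.curryLeft v - c • wedge v δ) = (-c) • interior v (wedge v δ) := by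
    cases p with
    | zero => simp [interior]
    | succ k =>
      ext w
      have h0 : η (Matrix.vecCons v (Matrix.vecCons v w)) = 0 :=
        η.map_eq_zero_of_eq (i := 0) (j := 1) _ (by simp) (by simp)
      simp [interior, h0]
  rw [h, innerForm_smul_left, innerForm_interior_wedge]
  ring

end LinearAlgebra

/-! ### Differentiating a form along vector fields -/

variable {E : Type*} [NormedAddCommGroup E] [NormedSpace ℝ E]
  {H : Type*} [TopologicalSpace H] (I : ModelWithCorners ℝ E H)
  {M : Type*} [TopologicalSpace M] [ChartedSpace H M]

theorem mvfderiv_apply_eq_fderivWithin {F : Type*} [NormedAddCommGroup F] [NormedSpace ℝ F]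
    {f : M → F} {x : M} (hf : MDiffAt f x) (v : TangentSpace I x) :
    mvfderiv I f x v
      = fderivWithin ℝ (f ∘ (extChartAt I x).symm) (Set.range I) (extChartAt I x x) v := by
  have h : mfderiv I 𝓘(ℝ, F) f x
      = (fderivWithin ℝ (f ∘ (extChartAt I x).symm) (Set.range I) (extChartAt I x x) :) :=
    if_pos hf
  exact congrArg (fun A : E →L[ℝ] F ↦ A v) h

theorem mvfderiv_congr {F : Type*} [NormedAddCommGroup F] [NormedSpace ℝ F]
    {f g : M → F} {x : M} (h : f =ᶠ[nhds x] g) (v : TangentSpace I x) :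
    mvfderiv I f x v = mvfderiv I g x v := by
  change (mfderiv I 𝓘(ℝ, F) f x v : F) = mfderiv I 𝓘(ℝ, F) g x v
  rw [h.mfderiv_eq]
  rfl

theorem mvfderiv_fun_sum {F : Type*} [NormedAddCommGroup F] [NormedSpace ℝ F] {ι : Type*}
    {s : Finset ι} {f : ι → M → F} {x : M} (hf : ∀ i ∈ s, MDiffAt (f i) x)
    (v : TangentSpace I x) : MDiffAt (fun y ↦ ∑ i ∈ s, f i y) x ∧
    mvfderiv I (fun y ↦ ∑ i ∈ s, f i y) x v = ∑ i ∈ s, mvfderiv I (f i) x v := by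
  have h (i) (hi : i ∈ s) : DifferentiableWithinAt ℝ (f i ∘ (extChartAt I x).symm) (Set.range I)
      (extChartAt I x x) := (hf i hi).differentiableWithinAt_writtenInExtChartAt
  have h' : MDiffAt (fun y ↦ ∑ i ∈ s, f i y) x :=
    (mdifferentiableAt_iff _ _).2 ⟨tendsto_finsetSum _ fun i hi ↦ (hf i hi).continuousAt,
      DifferentiableWithinAt.fun_sum h⟩
  refine ⟨h', ?_⟩
  rw [mvfderiv_apply_eq_fderivWithin I h', Finset.sum_congr rfl fun i hi ↦
    mvfderiv_apply_eq_fderivWithin I (hf i hi) v]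
  have := fderivWithin_fun_sum (I.uniqueDiffOn _ (Set.mem_range_self _)) h
  refine (congrArg (fun A : E →L[ℝ] F ↦ A v) this).trans ?_
  exact sum_apply _ _ _

theorem mvfderiv_alternating_apply {V : Type*} [NormedAddCommGroup V] [NormedSpace ℝ V] {k : ℕ}
    {f : M → V [⋀^Fin k]→L[ℝ] ℝ} {c : Fin k → M → V} {x : M} 
    (hf : MDifferentiableAt I 𝓘(ℝ, V [⋀^Fin k]→L[ℝ] ℝ) f x)
    (hc : ∀ i, MDiffAt (c i) x) (v : TangentSpace I x) :
    MDiffAt (fun y ↦ f y (c · y)) x ∧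
    mvfderiv I (fun y ↦ f y (c · y)) x v = mvfderiv I f x v (c · x)
      + ∑ i, f x (Function.update (c · x) i (mvfderiv I (c i) x v)) := by
  have hf' : DifferentiableWithinAt ℝ (f ∘ (extChartAt I x).symm) (Set.range I)
      (extChartAt I x x) := hf.differentiableWithinAt_writtenInExtChartAt
  have hc' (i) : DifferentiableWithinAt ℝ (c i ∘ (extChartAt I x).symm) (Set.range I)
      (extChartAt I x x) := (hc i).differentiableWithinAt_writtenInExtChartAt
  have h : MDiffAt (fun y ↦ f y (c · y)) x := by
    refine (mdifferentiableAt_iff _ _).2 ⟨?_, hf'.continuousAlternatingMap_apply hc'⟩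
    have h1 : DifferentiableAt ℝ (fun q : (V [⋀^Fin k]→L[ℝ] ℝ) × (Fin k → V) ↦ q.1 (q.2 ·))
        (f x, (c · x)) := differentiableAt_fst.continuousAlternatingMap_apply fun i ↦ by fun_prop
    exact ContinuousAt.comp (f := fun y ↦ (f y, (c · y))) h1.continuousAt
      (hf.continuousAt.prodMk (continuousAt_pi.2 fun i ↦ (hc i).continuousAt))
  refine ⟨h, ?_⟩
  rw [mvfderiv_apply_eq_fderivWithin I h, mvfderiv_apply_eq_fderivWithin I hf]
  simp only [mvfderiv_apply_eq_fderivWithin I (hc _)]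
  have := fderivWithin_continuousAlternatingMap_apply_apply hf' hc'
    (I.uniqueDiffOn _ (Set.mem_range_self _)) v
  simp only [Function.comp_apply, extChartAt_to_inv] at this
  exact this

theorem contMDiffAt_alternating_apply {V : Type*} [NormedAddCommGroup V] [NormedSpace ℝ V]
    [FiniteDimensional ℝ V] {k : ℕ} {n : ℕ∞ω}
    {f : M → V [⋀^Fin k]→L[ℝ] ℝ} {c : Fin k → M → V} {x : M} 
    (hf : ContMDiffAt I 𝓘(ℝ, V [⋀^Fin k]→L[ℝ] ℝ) n f x)
    (hc : ∀ i, CMDiffAt n (c i) x) : CMDiffAt n (fun y ↦ f y (c · y)) x := by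
  let b := Module.finBasis ℝ V
  have h (y : M) : f y (c · y)
      = ∑ t : Fin k → Fin (Module.finrank ℝ V),
        (∏ i, b.coord (t i) (c i y)) * f y (fun i ↦ b (t i)) := by
    have h1 : (c · y) = fun i ↦ ∑ j, b.coord j (c i y) • b j := by
      ext i
      exact (b.sum_repr _).symm
    rw [h1]
    refine ((f y).toMultilinearMap.map_sum _).trans (Finset.sum_congr rfl fun t _ ↦ ?_)
    exact (f y).toMultilinearMap.map_smul_univ _ _
  simp_rw [h]
  refine contMDiffAt_finsetSum fun t _ ↦ ?_
  refine ContMDiffAt.mul (contMDiffAt_finsetProd fun i _ ↦ ?_) ?_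
  · exact (b.coord (t i)).toContinuousLinearMap.contDiff.contMDiff.contMDiffAt.comp x (hc i)
  · exact (ContinuousAlternatingMap.apply ℝ V ℝ
      (fun i ↦ b (t i))).contDiff.contMDiff.contMDiffAt.comp x hf


variable [FiniteDimensional ℝ E] [IsManifold I ∞ M]
  [RiemannianBundle (fun x : M ↦ TangentSpace I x)]
  [IsContMDiffRiemannianBundle I ∞ E (fun x : M ↦ TangentSpace I x)]

/-- The coordinate expression near `x` of a vector field: the value `W y` read on `T_x M` through
the trivialization of the tangent bundle at `x`. It is inverse to `extendL`. -/
noncomputable def fieldRep (W : Π x : M, TangentSpace I x) (x y : M) : TangentSpace I x :=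
  (trivializationAt E (TangentSpace I) x).symmL ℝ x (trivializationAt E (TangentSpace I) x (W y)).2

theorem extendL_fieldRep (W : Π x : M, TangentSpace I x) {x y : M}
    (hy : y ∈ (trivializationAt E (TangentSpace I : M → Type _) x).baseSet) :
    extendL I x y (fieldRep I W x y) = W y := by
  have hx := FiberBundle.mem_baseSet_trivializationAt' (F := E)
    (E := (TangentSpace I : M → Type _)) x
  rw [extendL, fieldRep, ContinuousLinearMap.comp_apply,
    Trivialization.continuousLinearMapAt_symmL _ hx]
  rw [Trivialization.symmL_apply _ hy, Trivialization.symm_apply_apply_mk _ hy]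

theorem fieldRep_self (W : Π x : M, TangentSpace I x) (x : M) : fieldRep I W x x = W x := by
  rw [← extendL_self I x (fieldRep I W x x),
    extendL_fieldRep I W (FiberBundle.mem_baseSet_trivializationAt' x)]

theorem eventually_extendL_fieldRep (W : Π x : M, TangentSpace I x) (x : M) :
    ∀ᶠ y in nhds x, extendL I x y (fieldRep I W x y) = W y := by
  filter_upwards [(trivializationAt E (TangentSpace I : M → Type _) x).open_baseSet.mem_nhds
    (FiberBundle.mem_baseSet_trivializationAt' x)] with y hy
  exact extendL_fieldRep I W hy

variable {I} in
theorem mdifferentiableAt_fieldRep {W : Π x : M, TangentSpace I x} {x : M}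
    (hW : MDiffAt (T% W) x) :
    MDifferentiableAt I 𝓘(ℝ, TangentSpace I x) (fieldRep I W x) x := by
  rw [mdifferentiableAt_section] at hW
  exact ((trivializationAt E (TangentSpace I) x).symmL ℝ x).mdifferentiableAt.comp x hW

variable {I} in
theorem contMDiffAt_fieldRep {W : Π x : M, TangentSpace I x} {x : M} {n : ℕ∞ω}
    (hW : CMDiffAt n (T% W) x) :
    ContMDiffAt I 𝓘(ℝ, TangentSpace I x) n (fieldRep I W x) x := by
  rw [contMDiffAt_section] at hW
  exact ((trivializationAt E (TangentSpace I) x).symmL ℝ x).contMDiff.contMDiffAt.comp x hW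

variable {I}

theorem leviCivita_congr {Y Y' : Π x : M, TangentSpace I x} {x : M} (hY : MDiffAt (T% Y) x)
    (h : ∀ᶠ y in nhds x, Y y = Y' y) : leviCivita I Y x = leviCivita I Y' x := by
  have hY' : MDiffAt (T% Y') x := by
    refine hY.congr_of_eventuallyEq ?_
    filter_upwards [h] with y hy
    rw [hy]
  exact (leviCivita I).isCovariantDerivativeOn.congr_of_eventuallyEq hY hY' Filter.univ_mem h

theorem leviCivita_sum_smul {ι : Type*} (s : Finset ι) {f : ι → M → ℝ}
    {Y : ι → Π x : M, TangentSpace I x} {x : M} (hf : ∀ i, MDiffAt (f i) x)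
    (hY : ∀ i, MDiffAt (T% (Y i)) x) (v : TangentSpace I x) :
    MDiffAt (T% (fun y ↦ ∑ i ∈ s, f i y • Y i y)) x ∧
    leviCivita I (fun y ↦ ∑ i ∈ s, f i y • Y i y) x v
      = ∑ i ∈ s, (f i x • leviCivita I (Y i) x v + mvfderiv I (f i) x v • Y i x) := by
  classical
  induction s using Finset.induction_on with
  | empty =>
    have h : leviCivita I (0 : Π x : M, TangentSpace I x) = 0 := (leviCivita I).zero
    refine ⟨?_, ?_⟩
    · simp only [Finset.sum_empty]
      exact mdifferentiable_zeroSection ℝ (TangentSpace I : M → Type _) (IB := I) x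
    · simp only [Finset.sum_empty]
      exact congrArg (fun A ↦ A x v) h
  | insert i s hi ih =>
    have h1 := (leviCivita I).isCovariantDerivativeOn.leibniz (hY i) (hf i)
    have h2 : MDiffAt (T% (f i • Y i)) x := (hf i).smul_section (hY i)
    have h3 := (leviCivita I).isCovariantDerivativeOn.add h2 ih.1
    have h4 : (fun y ↦ ∑ j ∈ insert i s, f j y • Y j y)
        = f i • Y i + fun y ↦ ∑ j ∈ s, f j y • Y j y := by
      ext y
      simp [Finset.sum_insert hi]
    refine ⟨?_, ?_⟩
    · have h5 := mdifferentiableAt_add_section h2 ih.1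
      rwa [← h4] at h5
    rw [h4, Finset.sum_insert hi, ← ih.2, h3, h1]
    simp

/-- In coordinates the Levi-Civita connection is the derivative plus the connection form. -/
theorem leviCivita_eq_mvfderiv_add {W : Π x : M, TangentSpace I x} {x : M}
    (hW : MDiffAt (T% W) x) (v : TangentSpace I x) :
    leviCivita I W x v = mvfderiv I (fieldRep I W x) x v + connectionForm I x v (W x) := by
  let b := Module.finBasis ℝ (TangentSpace I x)
  let L (j) : TangentSpace I x →L[ℝ] ℝ := (b.coord j).toContinuousLinearMap
  have hc := mdifferentiableAt_fieldRep hW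
  have hd (j) : MDiffAt (fun y ↦ L j (fieldRep I W x y)) x :=
    (L j).mdifferentiableAt.comp x hc
  have hL (u : TangentSpace I x) : ∑ j, L j u • b j = u := b.sum_repr u
  have h1 : ∀ᶠ y in nhds x, W y = ∑ j, L j (fieldRep I W x y) • extendL I x y (b j) := by
    filter_upwards [eventually_extendL_fieldRep I W x] with y hy
    rw [← hy]
    conv_lhs => rw [← hL (fieldRep I W x y)]
    simp only [map_sum, map_smul]
  rw [leviCivita_congr hW h1, (leviCivita_sum_smul Finset.univ hd
    (fun j ↦ mdifferentiableAt_extendL I x (b j)) v).2, Finset.sum_add_distrib, add_comm]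
  congr 1
  · simp only [extendL_self]
    refine Eq.trans (Finset.sum_congr rfl fun j _ ↦ ?_) (hL _)
    congr 1
    exact (mvfderiv_comp_apply x (L j).mdifferentiableAt hc v).trans (by
      rw [mvfderiv, ContinuousLinearMap.mfderiv_eq]; rfl)
  · rw [fieldRep_self]
    conv_rhs => rw [← hL (W x), map_sum]
    simp only [map_smul]
    rfl

/-- The Leibniz rule `v(φ(W₁, …, W_p)) = (∇_v φ)(W₁, …, W_p) + ∑ i, φ(W₁, …, ∇_v W_i, …, W_p)`
for arbitrary vector fields. -/
theorem mvfderiv_form_apply {p : ℕ} {φ : Π x : M, TangentSpace I x [⋀^Fin p]→L[ℝ] ℝ} {x : M}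
    (hφ : MDifferentiableAt I 𝓘(ℝ, TangentSpace I x [⋀^Fin p]→L[ℝ] ℝ) (localRep I φ x) x)
    {W : Fin p → Π x : M, TangentSpace I x} (hW : ∀ i, MDiffAt (T% (W i)) x)
    (v : TangentSpace I x) :
    MDiffAt (fun y ↦ φ y (W · y)) x ∧
    mvfderiv I (fun y ↦ φ y (W · y)) x v = covDerivForm I φ x v (W · x)
      + ∑ i, φ x (Function.update (W · x) i (leviCivita I (W i) x v)) := by
  have h := mvfderiv_alternating_apply I hφ (fun i ↦ mdifferentiableAt_fieldRep (hW i)) v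
  have h1 : (fun y ↦ φ y (W · y)) =ᶠ[nhds x]
      fun y ↦ localRep I φ x y (fun i ↦ fieldRep I (W i) x y) := by
    filter_upwards [Filter.eventually_all.2 fun i ↦ eventually_extendL_fieldRep I (W i) x] with y hy
    change φ y _ = φ y _
    congr 1
    ext i
    exact (hy i).symm
  refine ⟨h.1.congr_of_eventuallyEq h1, ?_⟩
  rw [mvfderiv_congr I h1, h.2, covDerivForm, ContinuousAlternatingMap.sub_apply, derivation_apply]
  simp only [fieldRep_self]
  have h2 : localRep I φ x x = φ x := by
    ext w
    change φ x _ = φ x _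
    congr 1
    ext i
    exact extendL_self I x (w i)
  rw [h2, sub_add, ← Finset.sum_sub_distrib, ← sub_neg_eq_add, ← Finset.sum_neg_distrib]
  congr 1
  refine Finset.sum_congr rfl fun i _ ↦ ?_
  rw [leviCivita_eq_mvfderiv_add (hW i), ContinuousAlternatingMap.map_update_add]
  ring

theorem contMDiffAt_form_apply {p : ℕ} {φ : Π x : M, TangentSpace I x [⋀^Fin p]→L[ℝ] ℝ} {x : M}
    (hφ : ContMDiffAt I 𝓘(ℝ, TangentSpace I x [⋀^Fin p]→L[ℝ] ℝ) ∞ (localRep I φ x) x)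
    {W : Fin p → Π x : M, TangentSpace I x} (hW : ∀ i, CMDiffAt ∞ (T% (W i)) x) :
    CMDiffAt ∞ (fun y ↦ φ y (W · y)) x := by
  refine (contMDiffAt_alternating_apply I hφ fun i ↦
    contMDiffAt_fieldRep (hW i)).congr_of_eventuallyEq ?_
  filter_upwards [Filter.eventually_all.2 fun i ↦ eventually_extendL_fieldRep I (W i) x] with y hy
  change φ y _ = φ y _
  congr 1
  ext i
  exact (hy i).symm

/-! ### Smooth orthonormal frames and smoothness of the connection -/

theorem eventually_mdifferentiableAt {W : Π x : M, TangentSpace I x} {x : M}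
    (hW : CMDiffAt ∞ (T% W) x) : ∀ᶠ y in nhds x, MDiffAt (T% W) y := by
  have h : CMDiffAt 1 (T% W) x := hW.of_le (by norm_cast)
  filter_upwards [(contMDiffAt_iff_contMDiffAt_nhds (by simp)).1 h] with y hy
  exact hy.mdifferentiableAt (by simp)

theorem contMDiffAt_inner {X Y : Π x : M, TangentSpace I x} {x : M} (hX : CMDiffAt ∞ (T% X) x)
    (hY : CMDiffAt ∞ (T% Y) x) : CMDiffAt ∞ (fun y ↦ (inner ℝ (X y) (Y y) : ℝ)) x :=
  ContMDiffAt.inner_bundle (IB := I) (F := E) (E := fun x : M ↦ TangentSpace I x) hX hY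

theorem contMDiffAt_mvfderiv_apply {f : M → ℝ} {X : Π x : M, TangentSpace I x} {x : M}
    (hf : CMDiffAt ∞ f x) (hX : CMDiffAt ∞ (T% X) x) :
    CMDiffAt ∞ (fun y ↦ mvfderiv I f y (X y)) x := by
  have h1 := hf.mfderiv_const (m := ∞) (by simp)
  have h2 := ContMDiffAt.clm_apply_of_inCoordinates (b₁ := id) (b₂ := f) (F₁ := E) (F₂ := ℝ)
    (E₁ := (TangentSpace I : M → Type _)) (E₂ := (TangentSpace 𝓘(ℝ, ℝ) : ℝ → Type _))
    (ϕ := fun y ↦ mfderiv I 𝓘(ℝ, ℝ) f y) h1 hX hf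
  have h3 := (contMDiffAt_totalSpace.1 h2).2
  simp at h3
  exact h3

theorem contMDiffAt_extendL {x y : M}
    (hy : y ∈ (trivializationAt E (TangentSpace I : M → Type _) x).baseSet) (v : TangentSpace I x) :
    CMDiffAt ∞ (T% (fun y ↦ extendL I x y v)) y := by
  rw [(trivializationAt E (TangentSpace I : M → Type _) x).contMDiffAt_section_iff hy]
  refine (contMDiffAt_const (c := (trivializationAt E (TangentSpace I) x).continuousLinearMapAt ℝ x
    v)).congr_of_eventuallyEq ?_
  filter_upwards [(trivializationAt E (TangentSpace I : M → Type _) x).open_baseSet.mem_nhds hy]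
    with z hz
  rw [extendL, ContinuousLinearMap.comp_apply, Trivialization.symmL_apply _ hz,
    Trivialization.apply_mk_symm _ hz]

theorem extendL_injective {x y : M}
    (hy : y ∈ (trivializationAt E (TangentSpace I : M → Type _) x).baseSet) :
    Function.Injective (extendL I x y) := by
  have hx := FiberBundle.mem_baseSet_trivializationAt' (F := E)
    (E := (TangentSpace I : M → Type _)) x
  intro v w h
  have h1 := congrArg ((trivializationAt E (TangentSpace I) x).continuousLinearMapAt ℝ y) h
  rw [extendL, ContinuousLinearMap.comp_apply, ContinuousLinearMap.comp_apply,
    Trivialization.continuousLinearMapAt_symmL _ hy,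
    Trivialization.continuousLinearMapAt_symmL _ hy] at h1
  rw [← Trivialization.symmL_continuousLinearMapAt (R := ℝ) _ hx v, h1,
    Trivialization.symmL_continuousLinearMapAt _ hx]

theorem contMDiffAt_gramSchmidt {n : ℕ} {f : Fin n → Π x : M, TangentSpace I x} {x : M}
    (hf : ∀ i, CMDiffAt ∞ (T% (f i)) x) (hx : LinearIndependent ℝ (f · x)) (i : Fin n) :
    CMDiffAt ∞ (T% (fun y ↦ InnerProductSpace.gramSchmidt ℝ (f · y) i)) x := by
  induction i using WellFoundedLT.induction with
  | _ i ih =>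
    have h (y : M) : InnerProductSpace.gramSchmidt ℝ (f · y) i = f i y
        - ∑ j ∈ Finset.Iio i, ((inner ℝ (InnerProductSpace.gramSchmidt ℝ (f · y) j) (f i y) : ℝ)
          / inner ℝ (InnerProductSpace.gramSchmidt ℝ (f · y) j)
            (InnerProductSpace.gramSchmidt ℝ (f · y) j))
          • InnerProductSpace.gramSchmidt ℝ (f · y) j := by
      have h := InnerProductSpace.gramSchmidt_def'' ℝ (f · y) i
      simp only [RCLike.ofReal_real_eq_id, id_eq, ← real_inner_self_eq_norm_sq] at h
      exact eq_sub_of_add_eq h.symm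
    simp_rw [h]
    refine (hf i).sub_section (ContMDiffAt.sum_section fun j hj ↦ ?_)
    have hj' := ih j (Finset.mem_Iio.1 hj)
    refine ContMDiffAt.smul_section (ContMDiffAt.div₀ (contMDiffAt_inner hj' (hf i))
      (contMDiffAt_inner hj' hj') ?_) hj'
    exact inner_self_ne_zero.2 (InnerProductSpace.gramSchmidt_ne_zero j hx)

/-- Smooth orthonormal frames exist locally, by the Gram–Schmidt process. -/
theorem exists_orthonormalFrame (x : M) :
    ∃ e : Fin (Module.finrank ℝ E) → Π x : M, TangentSpace I x,
    (∀ i, CMDiffAt ∞ (T% (e i)) x) ∧ ∀ᶠ y in nhds x,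
      ∃ b : OrthonormalBasis (Fin (Module.finrank ℝ E)) ℝ (TangentSpace I y), ∀ i, b i = e i y := by
  let b : Module.Basis (Fin (Module.finrank ℝ E)) ℝ (TangentSpace I x) :=
    Module.finBasis ℝ (TangentSpace I x)
  let f (i) (y : M) : TangentSpace I y := extendL I x y (b i)
  have hx := FiberBundle.mem_baseSet_trivializationAt' (F := E)
    (E := (TangentSpace I : M → Type _)) x
  have hf (i) : CMDiffAt ∞ (T% (f i)) x := contMDiffAt_extendL hx (b i)
  have hli {y : M} (hy : y ∈ (trivializationAt E (TangentSpace I : M → Type _) x).baseSet) :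
      LinearIndependent ℝ (f · y) :=
    b.linearIndependent.map' (extendL I x y).toLinearMap
      (LinearMap.ker_eq_bot.2 (extendL_injective hy))
  refine ⟨fun i y ↦ (√(inner ℝ (InnerProductSpace.gramSchmidt ℝ (f · y) i)
    (InnerProductSpace.gramSchmidt ℝ (f · y) i)))⁻¹ • InnerProductSpace.gramSchmidt ℝ (f · y) i,
    fun i ↦ ?_, ?_⟩
  · have h := contMDiffAt_gramSchmidt hf (hli hx) i
    have h0 := InnerProductSpace.gramSchmidt_ne_zero i (hli hx)
    have h1 : (0 : ℝ) < inner ℝ (InnerProductSpace.gramSchmidt ℝ (f · x) i)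
        (InnerProductSpace.gramSchmidt ℝ (f · x) i) := real_inner_self_pos.2 h0
    refine ContMDiffAt.smul_section (ContMDiffAt.inv₀ ?_ (Real.sqrt_pos.2 h1).ne') h
    exact (Real.contDiffAt_sqrt h1.ne').contMDiffAt.comp x (contMDiffAt_inner h h)
  · filter_upwards [(trivializationAt E (TangentSpace I : M → Type _) x).open_baseSet.mem_nhds hx]
      with y hy
    have h := InnerProductSpace.gramSchmidtNormed_orthonormal (𝕜 := ℝ) (hli hy)
    have hc : Fintype.card (Fin (Module.finrank ℝ E)) = Module.finrank ℝ (TangentSpace I y) :=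
      Fintype.card_fin _
    refine ⟨OrthonormalBasis.mk h
      (h.linearIndependent.span_eq_top_of_card_eq_finrank' hc).ge, fun i ↦ ?_⟩
    rw [OrthonormalBasis.coe_mk, InnerProductSpace.gramSchmidtNormed, norm_eq_sqrt_real_inner]
    rfl

theorem contMDiffAt_koszul {X Y Z : Π x : M, TangentSpace I x} {x : M}
    (hX : CMDiffAt ∞ (T% X) x) (hY : CMDiffAt ∞ (T% Y) x) (hZ : CMDiffAt ∞ (T% Z) x) :
    CMDiffAt ∞ (koszul I X Y Z) x := by
  have hI : IsManifold I ((⊤ : ℕ∞) + 1) M := inferInstanceAs (IsManifold I ∞ M)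
  have hI2 : IsManifold I (minSmoothness ℝ 2) M := by
    rw [minSmoothness_of_isRCLikeNormedField]
    infer_instance
  have br {U V : Π x : M, TangentSpace I x} (hU : CMDiffAt ∞ (T% U) x)
      (hV : CMDiffAt ∞ (T% V) x) : CMDiffAt ∞ (T% (VectorField.mlieBracket I U V)) x :=
    ContMDiffAt.mlieBracket_vectorField (m := ⊤) (n := ⊤) hU hV (by simp)
  unfold koszul
  refine ContMDiffAt.mul contMDiffAt_const ?_
  refine ((((ContMDiffAt.add ?_ ?_).sub ?_).add ?_).sub ?_).add ?_
  · exact contMDiffAt_mvfderiv_apply (contMDiffAt_inner hY hZ) hX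
  · exact contMDiffAt_mvfderiv_apply (contMDiffAt_inner hZ hX) hY
  · exact contMDiffAt_mvfderiv_apply (contMDiffAt_inner hX hY) hZ
  · exact contMDiffAt_inner (br hX hY) hZ
  · exact contMDiffAt_inner (br hY hZ) hX
  · exact contMDiffAt_inner (br hZ hX) hY

/-- The Levi-Civita connection maps smooth vector fields to smooth vector fields. -/
theorem contMDiffAt_leviCivita {X Y : Π x : M, TangentSpace I x} {x : M}
    (hX : CMDiffAt ∞ (T% X) x) (hY : CMDiffAt ∞ (T% Y) x) :
    CMDiffAt ∞ (T% (fun y ↦ leviCivita I Y y (X y))) x := by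
  obtain ⟨e, he, hb⟩ := exists_orthonormalFrame (I := I) x
  have h : CMDiffAt ∞ (T% (fun y ↦ ∑ i, koszul I X Y (e i) y • e i y)) x :=
    ContMDiffAt.sum_section fun i _ ↦
      ContMDiffAt.smul_section (contMDiffAt_koszul hX hY (he i)) (he i)
  refine h.congr_of_eventuallyEq ?_
  filter_upwards [eventually_mdifferentiableAt hX, eventually_mdifferentiableAt hY, hb,
    Filter.eventually_all.2 fun i ↦ eventually_mdifferentiableAt (he i)] with y hXy hYy hby hey
  obtain ⟨b, hb⟩ := hby
  congr 1
  rw [← b.sum_repr' (leviCivita I Y y (X y))]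
  refine Finset.sum_congr rfl fun i _ ↦ ?_
  rw [real_inner_comm, hb, inner_leviCivita I hXy hYy (hey i)]

/-! ### Smoothness of tensor fields -/

/-- A section of `Hom(TM, V)` is smooth at `x` as soon as its values on the coordinate vector fields
at `x` are smooth. -/
theorem contMDiffAt_hom_of_extendL {F : Type*} [NormedAddCommGroup F] [NormedSpace ℝ F]
    {V : M → Type*} [∀ x, AddCommGroup (V x)] [∀ x, Module ℝ (V x)]
    [TopologicalSpace (TotalSpace F V)] [∀ x, TopologicalSpace (V x)]
    [∀ x, IsTopologicalAddGroup (V x)] [∀ x, ContinuousSMul ℝ (V x)]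
    [FiberBundle F V] [VectorBundle ℝ F V]
    {L : Π x : M, TangentSpace I x →L[ℝ] V x} {x : M}
    (h : ∀ v : TangentSpace I x, ContMDiffAt I (I.prod 𝓘(ℝ, F)) ∞
      (fun y ↦ TotalSpace.mk' F (E := V) y (L y (extendL I x y v))) x) :
    ContMDiffAt I (I.prod 𝓘(ℝ, E →L[ℝ] F)) ∞
      (fun y ↦ TotalSpace.mk' (E →L[ℝ] F) (E := fun y ↦ TangentSpace I y →L[ℝ] V y) y (L y)) x := by
  rw [contMDiffAt_hom_bundle]
  refine ⟨contMDiffAt_id, ?_⟩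
  let b := Module.finBasis ℝ E
  have hx := FiberBundle.mem_baseSet_trivializationAt' (F := E)
    (E := (TangentSpace I : M → Type _)) x
  have hx2 := FiberBundle.mem_baseSet_trivializationAt' (F := F) (E := V) x
  have h1 : ContMDiffAt I 𝓘(ℝ, E →L[ℝ] F) ∞ (fun y ↦ ∑ i,
      (b.coord i).toContinuousLinearMap.smulRight ((trivializationAt F V x ⟨y, L y (extendL I x y
        ((trivializationAt E (TangentSpace I) x).symmL ℝ x (b i)))⟩).2)) x := by
    refine contMDiffAt_finsetSum fun i _ ↦ ?_
    have h2 := (contMDiffAt_section x).1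
      (h ((trivializationAt E (TangentSpace I) x).symmL ℝ x (b i)))
    exact (ContinuousLinearMap.smulRightL ℝ E F
      (b.coord i).toContinuousLinearMap).contMDiff.contMDiffAt.comp x h2
  refine h1.congr_of_eventuallyEq ?_
  filter_upwards [(trivializationAt E (TangentSpace I : M → Type _) x).open_baseSet.mem_nhds hx,
    (trivializationAt F V x).open_baseSet.mem_nhds hx2] with y hy hy2
  refine ContinuousLinearMap.coe_injective (b.ext fun j ↦ ?_)
  simp only [ContinuousLinearMap.coe_coe]
  rw [ContinuousLinearMap.inCoordinates_eq hy hy2, sum_apply,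
    Finset.sum_eq_single j]
  · simp only [extendL, ContinuousLinearMap.comp_apply, ContinuousLinearMap.smulRight_apply,
      LinearMap.coe_toContinuousLinearMap']
    rw [Trivialization.continuousLinearMapAt_symmL _ hx]
    simp [Trivialization.symmL_apply _ hy]
  · intro i _ hij
    simp [hij.symm]
  · simp

theorem contMDiffAt_oneForm {P : Π x : M, TangentSpace I x →L[ℝ] ℝ} {x : M}
    (h : ∀ v : TangentSpace I x, CMDiffAt ∞ (fun y ↦ P y (extendL I x y v)) x) :
    ContMDiffAt I (I.prod 𝓘(ℝ, E →L[ℝ] ℝ)) ∞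
      (fun y ↦ TotalSpace.mk' (E →L[ℝ] ℝ) (E := fun y ↦ TangentSpace I y →L[ℝ] ℝ) y (P y)) x := by
  refine contMDiffAt_hom_of_extendL (F := ℝ) (V := Bundle.Trivial M ℝ) fun v ↦ ?_
  rw [contMDiffAt_section]
  exact h v

theorem contMDiffAt_bilin {K : Π x : M, TangentSpace I x →L[ℝ] TangentSpace I x →L[ℝ] ℝ} {x : M}
    (h : ∀ v w : TangentSpace I x,
      CMDiffAt ∞ (fun y ↦ K y (extendL I x y v) (extendL I x y w)) x) :
    ContMDiffAt I (I.prod 𝓘(ℝ, E →L[ℝ] E →L[ℝ] ℝ)) ∞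
      (fun y ↦ TotalSpace.mk' (E →L[ℝ] E →L[ℝ] ℝ)
        (E := fun y ↦ TangentSpace I y →L[ℝ] TangentSpace I y →L[ℝ] ℝ) y (K y)) x :=
  contMDiffAt_hom_of_extendL (F := E →L[ℝ] ℝ) (V := fun y ↦ TangentSpace I y →L[ℝ] ℝ)
    fun v ↦ contMDiffAt_oneForm fun w ↦ h v w

/-! ### The derivative of the contraction of two forms -/

section Contraction

variable {p : ℕ} {φ ψ : Π x : M, TangentSpace I x [⋀^Fin p]→L[ℝ] ℝ} {x : M}

theorem contMDiffAt_interior_apply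
    (hφ : ContMDiffAt I 𝓘(ℝ, TangentSpace I x [⋀^Fin p]→L[ℝ] ℝ) ∞ (localRep I φ x) x)
    {U : Π x : M, TangentSpace I x} (hU : CMDiffAt ∞ (T% U) x)
    {W : Fin (p - 1) → Π x : M, TangentSpace I x} (hW : ∀ i, CMDiffAt ∞ (T% (W i)) x) :
    CMDiffAt ∞ (fun y ↦ interior (U y) (φ y) (W · y)) x := by
  cases p with
  | zero => exact contMDiffAt_const
  | succ k =>
    have h := contMDiffAt_form_apply hφ (W := Fin.cons U W) (Fin.cases hU hW)
    convert h using 2 with y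
    change φ y _ = φ y _
    congr 1
    ext i
    refine Fin.cases rfl (fun i ↦ rfl) i

theorem mvfderiv_interior_apply
    (hφ : MDifferentiableAt I 𝓘(ℝ, TangentSpace I x [⋀^Fin p]→L[ℝ] ℝ) (localRep I φ x) x)
    {U : Π x : M, TangentSpace I x} (hU : MDiffAt (T% U) x)
    {W : Fin (p - 1) → Π x : M, TangentSpace I x} (hW : ∀ i, MDiffAt (T% (W i)) x)
    (v : TangentSpace I x) :
    mvfderiv I (fun y ↦ interior (U y) (φ y) (W · y)) x v
      = interior (U x) (covDerivForm I φ x v) (W · x)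
        + interior (leviCivita I U x v) (φ x) (W · x)
        + ∑ l, interior (U x) (φ x) (Function.update (W · x) l (leviCivita I (W l) x v)) := by
  cases p with
  | zero =>
    have h : mvfderiv I (fun _ : M ↦ (0 : ℝ)) x v = 0 := by
      rw [mvfderiv_const]
      rfl
    refine h.trans ?_
    simp [interior]
  | succ k =>
    have h := (mvfderiv_form_apply hφ (W := Fin.cons U W) (Fin.cases hU hW) v).2
    have h1 (y : M) : (fun i ↦ (Fin.cons U W : Fin (k + 1) → Π x : M, TangentSpace I x) i y)
        = Fin.cons (U y) (W · y) := by
      ext i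
      refine Fin.cases rfl (fun i ↦ rfl) i
    simp only [h1, Fin.sum_univ_succ, Fin.cons_zero, Fin.cons_succ, Fin.update_cons_zero,
      ← Fin.cons_update] at h
    rw [← add_assoc] at h
    exact h

/-- The contraction `⟨U ⌟ φ, V ⌟ ψ⟩` of smooth forms with smooth vector fields is smooth. -/
theorem contMDiffAt_innerForm_interior
    (hφ : ContMDiffAt I 𝓘(ℝ, TangentSpace I x [⋀^Fin p]→L[ℝ] ℝ) ∞ (localRep I φ x) x)
    (hψ : ContMDiffAt I 𝓘(ℝ, TangentSpace I x [⋀^Fin p]→L[ℝ] ℝ) ∞ (localRep I ψ x) x)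
    {U V : Π x : M, TangentSpace I x} (hU : CMDiffAt ∞ (T% U) x) (hV : CMDiffAt ∞ (T% V) x) :
    CMDiffAt ∞ (fun y ↦ innerForm (interior (U y) (φ y)) (interior (V y) (ψ y))) x := by
  obtain ⟨e, he, hb⟩ := exists_orthonormalFrame (I := I) x
  have h : CMDiffAt ∞ (fun y ↦ (1 / ((p - 1).factorial : ℝ)) * ∑ s : Fin (p - 1) → Fin _,
      interior (U y) (φ y) (fun i ↦ e (s i) y) * interior (V y) (ψ y) (fun i ↦ e (s i) y)) x :=
    contMDiffAt_const.mul (contMDiffAt_finsetSum fun s _ ↦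
      (contMDiffAt_interior_apply hφ hU fun i ↦ he (s i)).mul
        (contMDiffAt_interior_apply hψ hV fun i ↦ he (s i)))
  refine h.congr_of_eventuallyEq ?_
  filter_upwards [hb] with y ⟨b, hb⟩
  rw [innerForm_eq_sum _ _ b]
  simp only [hb]

/-- The Leibniz rule for `⟨U ⌟ φ, V ⌟ ψ⟩`. The derivatives of an orthonormal frame cancel, since
they are skew-symmetric. -/
theorem mvfderiv_innerForm_interior
    (hφ : ContMDiffAt I 𝓘(ℝ, TangentSpace I x [⋀^Fin p]→L[ℝ] ℝ) ∞ (localRep I φ x) x)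
    (hψ : ContMDiffAt I 𝓘(ℝ, TangentSpace I x [⋀^Fin p]→L[ℝ] ℝ) ∞ (localRep I ψ x) x)
    {U V : Π x : M, TangentSpace I x} (hU : CMDiffAt ∞ (T% U) x) (hV : CMDiffAt ∞ (T% V) x)
    (v : TangentSpace I x) :
    mvfderiv I (fun y ↦ innerForm (interior (U y) (φ y)) (interior (V y) (ψ y))) x v
      = innerForm (interior (U x) (covDerivForm I φ x v)) (interior (V x) (ψ x))
        + innerForm (interior (leviCivita I U x v) (φ x)) (interior (V x) (ψ x))
        + innerForm (interior (U x) (φ x)) (interior (V x) (covDerivForm I ψ x v))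
        + innerForm (interior (U x) (φ x)) (interior (leviCivita I V x v) (ψ x)) := by
  obtain ⟨e, he, hb⟩ := exists_orthonormalFrame (I := I) x
  obtain ⟨b, hbx⟩ := hb.self_of_nhds
  have h1 : (fun y ↦ innerForm (interior (U y) (φ y)) (interior (V y) (ψ y))) =ᶠ[nhds x]
      fun y ↦ ∑ s : Fin (p - 1) → Fin _, (1 / ((p - 1).factorial : ℝ)) *
        (interior (U y) (φ y) (fun i ↦ e (s i) y) * interior (V y) (ψ y) (fun i ↦ e (s i) y)) := by
    filter_upwards [hb] with y ⟨b, hb⟩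
    rw [innerForm_eq_sum _ _ b, Finset.mul_sum]
    simp only [hb]
  have hs {f : M → ℝ} (hf : CMDiffAt ∞ f x) : MDiffAt f x := hf.mdifferentiableAt (by simp)
  have hs' {W : Π x : M, TangentSpace I x} (hW : CMDiffAt ∞ (T% W) x) : MDiffAt (T% W) x :=
    hW.mdifferentiableAt (by simp)
  have hA (s : Fin (p - 1) → Fin (Module.finrank ℝ E)) :=
    hs (contMDiffAt_interior_apply hφ hU fun i ↦ he (s i))
  have hB (s : Fin (p - 1) → Fin (Module.finrank ℝ E)) :=
    hs (contMDiffAt_interior_apply hψ hV fun i ↦ he (s i))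
  have ha (i j) : inner ℝ (leviCivita I (e i) x v) (b j) + inner ℝ (b i) (leviCivita I (e j) x v)
      = (0 : ℝ) := by
    have h2 := mvfderiv_inner_eq I (FiberBundle.mdifferentiableAt_extend (I := I) (F := E) v)
      (hs' (he i)) (hs' (he j))
    have h3 : (fun y ↦ (inner ℝ (e i y) (e j y) : ℝ)) =ᶠ[nhds x]
        fun _ ↦ if i = j then 1 else 0 := by
      filter_upwards [hb] with y ⟨b, hb⟩
      rw [← hb, ← hb]
      exact orthonormal_iff_ite.1 b.orthonormal i j
    rw [mvfderiv_congr I h3, mvfderiv_const] at h2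
    simp only [FiberBundle.extend_apply_self] at h2
    rw [hbx, hbx, ← h2]
    rfl
  have key := sum_update_mul_add_mul_update_eq_zero (interior (U x) (φ x)) (interior (V x) (ψ x)) b
    (fun i ↦ leviCivita I (e i) x v) ha
  have hT (s : Fin (p - 1) → Fin (Module.finrank ℝ E)) :
      MDiffAt (fun y ↦ (1 / ((p - 1).factorial : ℝ)) * (interior (U y) (φ y) (fun i ↦ e (s i) y)
        * interior (V y) (ψ y) (fun i ↦ e (s i) y))) x :=
    (hs contMDiffAt_const).mul ((hA s).mul (hB s))
  rw [mvfderiv_congr I h1, (mvfderiv_fun_sum I (fun s _ ↦ hT s) v).2]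
  have h4 (s : Fin (p - 1) → Fin (Module.finrank ℝ E)) := mvfderiv_interior_apply
    (hφ.mdifferentiableAt (by simp)) (hs' hU) (fun i ↦ hs' (he (s i))) v
  have h5 (s : Fin (p - 1) → Fin (Module.finrank ℝ E)) := mvfderiv_interior_apply
    (hψ.mdifferentiableAt (by simp)) (hs' hV) (fun i ↦ hs' (he (s i))) v
  have h6 (s : Fin (p - 1) → Fin (Module.finrank ℝ E)) :
      mvfderiv I (fun y ↦ (1 / ((p - 1).factorial : ℝ)) * (interior (U y) (φ y) (fun i ↦ e (s i) y)
        * interior (V y) (ψ y) (fun i ↦ e (s i) y))) x v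
      = (1 / ((p - 1).factorial : ℝ)) * (interior (U x) (φ x) (fun i ↦ e (s i) x)
          * mvfderiv I (fun y ↦ interior (V y) (ψ y) (fun i ↦ e (s i) y)) x v
        + interior (V x) (ψ x) (fun i ↦ e (s i) x)
          * mvfderiv I (fun y ↦ interior (U y) (φ y) (fun i ↦ e (s i) y)) x v) := by
    have h7 := mvfderiv_fun_mul (hs (contMDiffAt_const (c := 1 / ((p - 1).factorial : ℝ))))
      ((hA s).mul (hB s))
    have h8 := mvfderiv_mul (hA s) (hB s)
    rw [h8, mvfderiv_const] at h7
    refine (congrArg (fun A ↦ A v) h7).trans ?_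
    simp
    ring
  simp only [h6, h4, h5]
  rw [innerForm_eq_sum _ _ b, innerForm_eq_sum _ _ b, innerForm_eq_sum _ _ b,
    innerForm_eq_sum _ _ b]
  simp only [← hbx] at key ⊢
  rw [← Finset.mul_sum, ← mul_add, ← mul_add, ← mul_add]
  congr 1
  rw [← add_zero (_ + _ + _ + _), ← key]
  simp only [← Finset.sum_add_distrib]
  exact Finset.sum_congr rfl fun s _ ↦ by ring

end Contraction

/-! ### The conformal Killing tensor -/

section KillingTensor

variable {p : ℕ} {φ ψ : Π x : M, TangentSpace I x [⋀^Fin p]→L[ℝ] ℝ}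

theorem killingTensor_apply_self (φ ψ : Π x : M, TangentSpace I x [⋀^Fin p]→L[ℝ] ℝ) (x : M)
    (v : TangentSpace I x) : killingTensor I φ ψ x v v
      = 2 * innerForm (interior v (φ x)) (interior v (ψ x)) := by
  rw [killingTensor, killingBilin_apply, two_mul]

theorem killingTensor_symm (φ ψ : Π x : M, TangentSpace I x [⋀^Fin p]→L[ℝ] ℝ) (x : M)
    (v w : TangentSpace I x) : killingTensor I φ ψ x v w = killingTensor I φ ψ x w v := by
  rw [killingTensor, killingBilin_apply, killingBilin_apply, add_comm]

theorem contMDiffAt_killingTensor_apply (hφ : IsSmoothForm I φ) (hψ : IsSmoothForm I ψ)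
    {U V : Π x : M, TangentSpace I x} {x : M} (hU : CMDiffAt ∞ (T% U) x)
    (hV : CMDiffAt ∞ (T% V) x) : CMDiffAt ∞ (fun y ↦ killingTensor I φ ψ y (U y) (V y)) x :=
  (contMDiffAt_innerForm_interior (hφ x) (hψ x) hU hV).add
    (contMDiffAt_innerForm_interior (hφ x) (hψ x) hV hU)

/-- For arbitrary smooth forms the terms with derivatives of `X` cancel, and
`(∇_X K)(X, X) = 2⟨X ⌟ ∇_X φ, X ⌟ ψ⟩ + 2⟨X ⌟ φ, X ⌟ ∇_X ψ⟩`. -/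
theorem covDerivBilin_killingTensor (hφ : IsSmoothForm I φ) (hψ : IsSmoothForm I ψ)
    {X : Π x : M, TangentSpace I x} {x : M} (hX : CMDiffAt ∞ (T% X) x) :
    covDerivBilin I (killingTensor I φ ψ) X X X x
      = 2 * innerForm (interior (X x) (covDerivForm I φ x (X x))) (interior (X x) (ψ x))
        + 2 * innerForm (interior (X x) (φ x)) (interior (X x) (covDerivForm I ψ x (X x))) := by
  have h1 := contMDiffAt_innerForm_interior (hφ x) (hψ x) hX hX
  have h2 := mvfderiv_innerForm_interior (hφ x) (hψ x) hX hX (X x)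
  have h3 : (fun y ↦ killingTensor I φ ψ y (X y) (X y)) = fun y ↦ ∑ _ : Fin 2,
      innerForm (interior (X y) (φ y)) (interior (X y) (ψ y)) := by
    ext y
    rw [killingTensor_apply_self, Fin.sum_univ_two, two_mul]
  rw [covDerivBilin, h3, (mvfderiv_fun_sum I (fun _ _ ↦ h1.mdifferentiableAt (by simp)) (X x)).2,
    Fin.sum_univ_two, h2, killingTensor, killingBilin_apply, killingBilin_apply]
  ring

theorem covDerivBilin_killingTensor_eq (hφ : IsConformalKillingForm I φ)
    (hψ : IsConformalKillingForm I ψ) {X : Π x : M, TangentSpace I x} {x : M}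
    (hX : CMDiffAt ∞ (T% X) x) :
    covDerivBilin I (killingTensor I φ ψ) X X X x
      = killingOneForm I φ ψ x (X x) * inner ℝ (X x) (X x) := by
  have h : killingOneForm I φ ψ x (X x) = -(2 / ((Module.finrank ℝ E : ℝ) - p + 1)) *
      (innerForm (codiff I φ x) (interior (X x) (ψ x))
        + innerForm (codiff I ψ x) (interior (X x) (φ x))) := rfl
  rw [covDerivBilin_killingTensor hφ.smooth hψ.smooth hX, innerForm_comm (interior (X x) (φ x)),
    hφ.eq, hψ.eq, innerForm_interior_twistor, innerForm_interior_twistor, h]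
  ring

theorem contMDiffAt_covDerivBilin_killingTensor (hφ : IsSmoothForm I φ) (hψ : IsSmoothForm I ψ)
    {X : Π x : M, TangentSpace I x} {x : M} (hX : CMDiffAt ∞ (T% X) x) :
    CMDiffAt ∞ (covDerivBilin I (killingTensor I φ ψ) X X X) x := by
  have h := contMDiffAt_leviCivita hX hX
  exact ((contMDiffAt_mvfderiv_apply (contMDiffAt_killingTensor_apply hφ hψ hX hX) hX).sub
    (contMDiffAt_killingTensor_apply hφ hψ h hX)).sub (contMDiffAt_killingTensor_apply hφ hψ hX h)

/-- Along a nonvanishing vector field `X`, the 1-form satisfies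
`P(X) = (∇_X K)(X, X) / g(X, X)`; hence it is smooth. -/
theorem contMDiffAt_killingOneForm_apply (hφ : IsConformalKillingForm I φ)
    (hψ : IsConformalKillingForm I ψ) (x : M) (v : TangentSpace I x) :
    CMDiffAt ∞ (fun y ↦ killingOneForm I φ ψ y (extendL I x y v)) x := by
  have hx := FiberBundle.mem_baseSet_trivializationAt' (F := E)
    (E := (TangentSpace I : M → Type _)) x
  rcases eq_or_ne v 0 with rfl | hv
  · simpa using contMDiffAt_const
  have hne {y : M} (hy : y ∈ (trivializationAt E (TangentSpace I : M → Type _) x).baseSet) :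
      (inner ℝ (extendL I x y v) (extendL I x y v) : ℝ) ≠ 0 :=
    inner_self_ne_zero.2 ((map_ne_zero_iff _ (extendL_injective hy)).2 hv)
  have hX := contMDiffAt_extendL hx v
  refine ((contMDiffAt_covDerivBilin_killingTensor hφ.smooth hψ.smooth hX).div₀
    (contMDiffAt_inner hX hX) (hne hx)).congr_of_eventuallyEq ?_
  filter_upwards [(trivializationAt E (TangentSpace I : M → Type _) x).open_baseSet.mem_nhds hx]
    with y hy
  rw [Pi.div_apply, eq_div_iff (hne hy),
    covDerivBilin_killingTensor_eq hφ hψ (contMDiffAt_extendL hy v)]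

theorem isAssociatedOneForm_killingOneForm (hφ : IsConformalKillingForm I φ)
    (hψ : IsConformalKillingForm I ψ) :
    IsAssociatedOneForm I (killingTensor I φ ψ) (killingOneForm I φ ψ) where
  smooth x := contMDiffAt_oneForm fun v ↦ contMDiffAt_killingOneForm_apply hφ hψ x v
  eq _ _ hX := covDerivBilin_killingTensor_eq hφ hψ hX

theorem isConformalKillingTensor_killingTensor (hφ : IsConformalKillingForm I φ)
    (hψ : IsConformalKillingForm I ψ) : IsConformalKillingTensor I (killingTensor I φ ψ) where
  smooth x := contMDiffAt_bilin fun v w ↦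
    have hx := FiberBundle.mem_baseSet_trivializationAt' (F := E)
      (E := (TangentSpace I : M → Type _)) x
    contMDiffAt_killingTensor_apply hφ.smooth hψ.smooth (contMDiffAt_extendL hx v)
      (contMDiffAt_extendL hx w)
  symm := killingTensor_symm φ ψ
  exists_oneForm := ⟨_, isAssociatedOneForm_killingOneForm hφ hψ⟩

end KillingTensor

end ConformalKilling

theorem mainTheorem3 {E : Type*} [NormedAddCommGroup E] [NormedSpace ℝ E] [FiniteDimensional ℝ E]
    {H : Type*} [TopologicalSpace H] (I : ModelWithCorners ℝ E H)
    {M : Type*} [TopologicalSpace M] [ChartedSpace H M]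
    [IsManifold I ∞ M] [BoundarylessManifold I M] [RiemannianBundle (fun x : M ↦ TangentSpace I x)]
    [IsContMDiffRiemannianBundle I ∞ E (fun x : M ↦ TangentSpace I x)]
    {p : ℕ} (φ ψ : Π x : M, TangentSpace I x [⋀^Fin p]→L[ℝ] ℝ)
    (hφ : IsConformalKillingForm I φ) (hψ : IsConformalKillingForm I ψ) :
    IsConformalKillingTensor I (killingTensor I φ ψ) ∧
      IsAssociatedOneForm I (killingTensor I φ ψ) (killingOneForm I φ ψ) := by
  exact ⟨isConformalKillingTensor_killingTensor hφ hψ, isAssociatedOneForm_killingOneForm hφ hψ⟩
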